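/- Let $k$ be a field of odd characteristic $p$, let $K=k(t)$ be the field of rational functions, and let $f:\mathbf P^1_{K,y}\to\mathbf P^1_{K,x}$ be the Artin–Schreier map $y\mapsto y^p-y$, of degree $p$. Write $Y$ and $X$ for the source and the target, let $\mathcal V=\operatorname{Hom}(f^*T^\vee X,T^\vee Y)$, and regard $df$ as a section of $\mathcal V$. Let $\mathrm{GW}(K)$ be the Grothendieck–Witt group of nondegenerate symmetric bilinear forms over $K$, and let $h=\langle1\rangle+\langle-1\rangle$. A relative orientation of $\mathcal V$ is a line bundle $M$ on $Y$ with an isomorphism $\operatorname{Hom}(TY,\mathcal V)\cong M^{\otimes2}$. Given one, the local index (branch index) $\operatorname{ind}_P\,df\in\mathrm{GW}(K)$ at a zero $P$ of $df$ is defined as follows. Choose Nisnevich coordinates $\varphi$ at $P$ (a function on a neighbourhood of $P$ that is étale at $P$ as a map to $\mathbf A^1_K=\operatorname{Spec}K[u]$ and induces an isomorphism of residue fields), and a local generator $e$ of $\mathcal V$ at $P$ such that $(\partial_\varphi\mapsto e)$ corresponds to $s\otimes s$ for a local generator $s$ of $M$. Write $df=g\cdot e$. For $N$ large choose $G\in R=\mathcal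 O_{\mathbf A^1_K,\varphi(P)}$ with $\varphi^*G\equiv g\bmod\mathfrak m_P^N$, write $G\otimes1-1\otimes G=a\,(u\otimes1-1\otimes u)$ in $R\otimes_KR$, and put $Q=R/(G)$. Let $\Theta:\operatorname{Hom}_K(Q,K)\to Q$ be the map that the image of $a$ in $Q\otimes_KQ$ induces by $b\otimes c\mapsto(\mu\mapsto\mu(b)c)$, and let $\eta=\Theta^{-1}(1)$. Then $\operatorname{ind}_P\,df$ is the class of the form $(b,c)\mapsto\eta(bc)$ on $Q$. Then there is a relative orientation of $\mathcal V$ for which the following hold. The only zero of $df$ is $\infty$; the local index at $\infty$ exists, and for all sufficiently large $N$ it does not depend on the choices made; and $$\operatorname{ind}_\infty df=(p-1)\cdot h\quad\text{in }\mathrm{GW}(k(t)).$$ Consequently the enriched Riemann–Hurwitz formula $$\chi^{\mathbf A^1}(Y)=\deg(f)\cdot\chi^{\mathbf A^1}(X)-\sum_{P:\,df(P)=0}\operatorname{ind}_P\,df$$ holds in $\mathrm{GW}(k(t))$, where $\chi^{\mathbf A^1}(C)=(1-g(C))\cdot h$ for a smooth projective curve $C$ of genus $g(C)$. -/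

import Mathlib

open scoped TensorProduct Polynomial

noncomputable section

namespace EnrichedRH

universe u

/-! ### The Grothendieck–Witt group -/

/-- A nondegenerate symmetric bilinear form on a finite-dimensional `K`-vector space. -/
structure SymForm (K : Type u) [Field K] where
  V : Type u
  [addCommGroup : AddCommGroup V]
  [module : Module K V]
  [finite : Module.Finite K V]
  form : LinearMap.BilinForm K V
  symm : form.IsSymm
  nondeg : form.Nondegenerate

attribute [instance] SymForm.addCommGroup SymForm.module SymForm.finite

namespace SymForm

variable {K : Type u} [Field K]

/-- Two forms are identified when they are isometric. -/
instance setoid (K : Type u) [Field K] : Setoid (SymForm K) where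
  r B C := LinearMap.BilinForm.Equivalent B.form C.form
  iseqv := ⟨fun B => .refl B.form, fun h => h.symm, fun h h' => h.trans h'⟩

/-- The orthogonal sum of bilinear forms. -/
def orthSum {V W : Type u} [AddCommGroup V] [Module K V] [AddCommGroup W] [Module K W]
    (B : LinearMap.BilinForm K V) (C : LinearMap.BilinForm K W) :
    LinearMap.BilinForm K (V × W) :=
  B.comp (LinearMap.fst K V W) (LinearMap.fst K V W) +
    C.comp (LinearMap.snd K V W) (LinearMap.snd K V W)

@[simp] theorem orthSum_apply {V W : Type u} [AddCommGroup V] [Module K V] [AddCommGroup W]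
    [Module K W] (B : LinearMap.BilinForm K V) (C : LinearMap.BilinForm K W) (x y : V × W) :
    orthSum B C x y = B x.1 y.1 + C x.2 y.2 := rfl

/-- The orthogonal sum of two nondegenerate symmetric forms. -/
def add (B C : SymForm K) : SymForm K where
  V := B.V × C.V
  form := orthSum B.form C.form
  symm := ⟨fun x y => by simp [B.symm.eq x.1 y.1, C.symm.eq x.2 y.2]⟩
  nondeg := by
    refine ⟨fun x hx => Prod.ext ?_ ?_, fun x hx => Prod.ext ?_ ?_⟩
    · exact B.nondeg.1 _ fun v => by simpa using hx (v, 0)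
    · exact C.nondeg.1 _ fun v => by simpa using hx (0, v)
    · exact B.nondeg.2 _ fun v => by simpa using hx (v, 0)
    · exact C.nondeg.2 _ fun v => by simpa using hx (0, v)

/-- The form on the zero space. -/
def zero (K : Type u) [Field K] : SymForm K where
  V := PUnit
  form := 0
  symm := ⟨fun _ _ => rfl⟩
  nondeg := ⟨fun _ _ => rfl, fun _ _ => rfl⟩

/-- The form `(x, y) ↦ a x y` on `K`. -/
def rankOne (a : Kˣ) : SymForm K where
  V := K
  form := (a : K) • LinearMap.mul K K
  symm := ⟨fun x y => by simp [mul_comm x y]⟩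
  nondeg := ⟨fun x hx => by simpa using hx 1, fun x hx => by simpa using hx 1⟩

end SymForm

/-- Isometry classes of nondegenerate symmetric bilinear forms over `K`. -/
def FormClass (K : Type u) [Field K] : Type (u + 1) := Quotient (SymForm.setoid K)

/-- Orthogonal sum of isometry classes. -/
instance (K : Type u) [Field K] : Add (FormClass K) where
  add := Quotient.map₂ SymForm.add fun _ _ ⟨e⟩ _ _ ⟨e'⟩ =>
    ⟨⟨LinearEquiv.prodCongr e.toLinearEquiv e'.toLinearEquiv, fun x y =>
      congrArg₂ (· + ·) (e.map_app' x.1 y.1) (e'.map_app' x.2 y.2)⟩⟩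

instance (K : Type u) [Field K] : Zero (FormClass K) where
  zero := Quotient.mk (SymForm.setoid K) (SymForm.zero K)

/-- Isometry classes form a commutative monoid under orthogonal sum. -/
instance (K : Type u) [Field K] : AddCommMonoid (FormClass K) where
  add_assoc := by
    rintro ⟨B⟩ ⟨C⟩ ⟨D⟩
    exact Quotient.sound ⟨⟨LinearEquiv.prodAssoc K B.V C.V D.V, fun x y =>
      (add_assoc (B.form x.1.1 y.1.1) (C.form x.1.2 y.1.2) (D.form x.2 y.2)).symm⟩⟩
  zero_add := by
    rintro ⟨B⟩
    exact Quotient.sound ⟨⟨LinearEquiv.uniqueProd (R := K) (M := B.V) (M₂ := PUnit.{u + 1}),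
      fun x y => (zero_add (B.form x.2 y.2)).symm⟩⟩
  add_zero := by
    rintro ⟨B⟩
    exact Quotient.sound ⟨⟨LinearEquiv.prodUnique (R := K) (M := B.V) (M₂ := PUnit.{u + 1}),
      fun x y => (add_zero (B.form x.1 y.1)).symm⟩⟩
  add_comm := by
    rintro ⟨B⟩ ⟨C⟩
    exact Quotient.sound ⟨⟨LinearEquiv.prodComm K B.V C.V, fun x y =>
      add_comm (C.form x.2 y.2) (B.form x.1 y.1)⟩⟩
  nsmul := nsmulRec

/-- The (additive) Grothendieck–Witt group: the group completion of the monoid of isometry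
classes of nondegenerate symmetric bilinear forms under orthogonal sum. -/
abbrev GW (K : Type u) [Field K] : Type (u + 1) := Algebra.GrothendieckAddGroup (FormClass K)

namespace GW

/-- The class in `GW K` of a nondegenerate symmetric form. -/
def mk {K : Type u} [Field K] (B : SymForm K) : GW K :=
  Algebra.GrothendieckAddGroup.of (Quotient.mk (SymForm.setoid K) B : FormClass K)

/-- `⟨a⟩`. -/
def unit {K : Type u} [Field K] (a : Kˣ) : GW K := mk (SymForm.rankOne a)

/-- The hyperbolic class `h = ⟨1⟩ + ⟨-1⟩`. -/
def hyp (K : Type u) [Field K] : GW K := unit 1 + unit (-1)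

open Classical in
/-- The class of a bilinear form on a `K`-vector space (the junk value `0` if the form is not a
nondegenerate symmetric form on a finite-dimensional space). -/
def ofForm {K : Type u} [Field K] {V : Type u} [AddCommGroup V] [Module K V]
    (B : LinearMap.BilinForm K V) : GW K :=
  if h : Module.Finite K V ∧ B.IsSymm ∧ B.Nondegenerate then
    haveI := h.1
    mk { V := V, form := B, symm := h.2.1, nondeg := h.2.2 }
  else 0

end GW

/-! ### The regular projective curve with a given function field

A regular projective curve `C` over `K` is handled through its function field `F`: its points are
the valuation rings of `F` that contain `K` (the local rings of `C`), the ring `F` itself being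
the local ring at the generic point, and the closed points being the others.  For `F = K(y)` this
is the projective line with affine coordinate `y`: its closed points are the maximal ideals of
`K[y]` and the point `∞`, with local rings the corresponding discrete valuation rings. -/

/-- A point of the regular projective curve over `K` with function field `F`, given by its
local ring inside `F`. -/
structure Point (K F : Type u) [Field K] [Field F] [Algebra K F] where
  ring : ValuationSubring F
  algebraMap_mem : ∀ c : K, algebraMap K F c ∈ ring

section Curve

variable {K F : Type u} [Field K] [Field F] [Algebra K F]

instance (P : Point K F) : Algebra K P.ring :=
  ((algebraMap K F).codRestrict P.ring P.algebraMap_mem).toAlgebra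

instance (P : Point K F) : IsScalarTower K P.ring F := .of_algebraMap_eq fun _ => rfl

/-- The maximal ideal of the local ring at `P`. -/
abbrev Point.max (P : Point K F) : Ideal P.ring := IsLocalRing.maximalIdeal P.ring

/-- A torsion-free sheaf of modules on the curve, given by its stalk `gen` at the generic point
and, inside it, its stalk at every point. Its sections over an open set `U` are the elements of
`gen` that lie in the stalks at all points of `U`. -/
structure CurveSheaf (K F : Type u) [Field K] [Field F] [Algebra K F] where
  gen : Type u
  [addCommGroup : AddCommGroup gen]
  [module : Module F gen]
  stalk : ∀ P : Point K F, Submodule P.ring gen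

attribute [instance] CurveSheaf.addCommGroup CurveSheaf.module

namespace CurveSheaf

/-- Line bundles: the generic stalk has dimension one, all stalks are free of rank one, and a
nonzero rational section generates the stalks at all but finitely many points. -/
structure IsLineBundle (L : CurveSheaf K F) : Prop where
  rank_one : Module.finrank F L.gen = 1
  locally_free : ∀ P : Point K F, ∃ e : L.gen, e ≠ 0 ∧ L.stalk P = Submodule.span P.ring {e}
  coherent : ∀ e : L.gen, e ≠ 0 →
    {P : Point K F | L.stalk P ≠ Submodule.span P.ring {e}}.Finite

/-- The structure sheaf. -/
def structureSheaf (K F : Type u) [Field K] [Field F] [Algebra K F] : CurveSheaf K F where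
  gen := F
  stalk P := Submodule.span P.ring {(1 : F)}

/-- The cotangent sheaf `T^∨ C = Ω_{C/K}`: the stalk at `P` consists of the `P.ring`-linear
combinations of the differentials of elements of the local ring at `P`. -/
def cotangent (K F : Type u) [Field K] [Field F] [Algebra K F] : CurveSheaf K F where
  gen := Ω[F⁄K]
  stalk P := Submodule.span P.ring
    (Set.range fun a : P.ring => KaehlerDifferential.D K F (a : F))

/-- The sheaf `Hom(L, L')`. -/
def hom (L L' : CurveSheaf K F) : CurveSheaf K F where
  gen := L.gen →ₗ[F] L'.gen
  stalk P :=
    { carrier := {φ | ∀ x ∈ L.stalk P, φ x ∈ L'.stalk P}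
      add_mem' := fun hφ hψ x hx => (L'.stalk P).add_mem (hφ x hx) (hψ x hx)
      zero_mem' := fun _ _ => (L'.stalk P).zero_mem
      smul_mem' := fun c _ hφ x hx => (L'.stalk P).smul_mem c (hφ x hx) }

/-- The tangent sheaf, dual to the cotangent sheaf. -/
def tangent (K F : Type u) [Field K] [Field F] [Algebra K F] : CurveSheaf K F :=
  hom (cotangent K F) (structureSheaf K F)

/-- The tensor product `L ⊗ L'`. -/
def tensor (L L' : CurveSheaf K F) : CurveSheaf K F where
  gen := L.gen ⊗[F] L'.gen
  stalk P := Submodule.span P.ring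
    {t | ∃ x ∈ L.stalk P, ∃ y ∈ L'.stalk P, t = x ⊗ₜ[F] y}

/-- The section `s` of `L` vanishes at `P`, that is, `s ∈ 𝔪_P L_P`. -/
def Vanishes (L : CurveSheaf K F) (s : L.gen) (P : Point K F) : Prop :=
  s ∈ P.max • L.stalk P

/-- A relative orientation of a line bundle `L` on the curve `C`: a line bundle `M` and an
isomorphism `M ⊗ M ≅ Hom(T C, L)`. -/
structure RelativeOrientation (L : CurveSheaf K F) where
  M : CurveSheaf K F
  isLineBundle : M.IsLineBundle
  iso : (M.tensor M).gen ≃ₗ[F] ((tangent K F).hom L).gen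
  mem_stalk_iff : ∀ (P : Point K F) (t : (M.tensor M).gen),
    iso t ∈ ((tangent K F).hom L).stalk P ↔ t ∈ (M.tensor M).stalk P

end CurveSheaf

/-- Global differentials, `H⁰(C, Ω_{C/K})`. -/
def globalDifferentials (K F : Type u) [Field K] [Field F] [Algebra K F] :
    Submodule K Ω[F⁄K] where
  carrier := {ω | ∀ P : Point K F, ω ∈ (CurveSheaf.cotangent K F).stalk P}
  add_mem' h h' P := Submodule.add_mem _ (h P) (h' P)
  zero_mem' P := Submodule.zero_mem _
  smul_mem' c ω h P := by
    have := Submodule.smul_mem _ (algebraMap K P.ring c) (h P)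
    have e : (algebraMap K P.ring c) • ω = c • ω := by
      rw [← algebraMap_smul F c ω]; rfl
    exact e ▸ this

/-- The genus of the curve. -/
def genus (K F : Type u) [Field K] [Field F] [Algebra K F] : ℕ :=
  Module.finrank K (globalDifferentials K F)

/-- `χ(C) = (1 - g) · h`, the value of the `𝐀¹`-Euler characteristic of a smooth projective
curve of genus `g`. -/
def eulerChar (K F : Type u) [Field K] [Field F] [Algebra K F] : GW K :=
  (1 - (genus K F : ℤ)) • GW.hyp K

/-! ### The local index -/

/-- Nisnevich coordinates around `P`: a function `φ` on a neighbourhood of `P` that is étale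
at `P` as a map to the affine line (for a smooth curve: its differential generates the cotangent
stalk) and induces an isomorphism of residue fields at `P` and `φ(P)`. -/
structure NisnevichCoordinate (P : Point K F) where
  φ : P.ring
  etale : (CurveSheaf.cotangent K F).stalk P =
    Submodule.span P.ring {KaehlerDifferential.D K F (φ : F)}
  residue : ∀ a : P.ring, ∃ g : K[X], a - Polynomial.aeval φ g ∈ P.max

namespace NisnevichCoordinate

variable {P : Point K F} (c : NisnevichCoordinate P)

/-- The point `φ(P)` of the affine line `Spec K[X]`. -/
abbrev image : Ideal K[X] :=
  P.max.comap (Polynomial.aeval c.φ : K[X] →ₐ[K] P.ring)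

/-- The local ring of the affine line at `φ(P)`. -/
abbrev LocalRing : Type u := Localization.AtPrime c.image

/-- The coordinate of the affine line, in its local ring at `φ(P)`. -/
abbrev X : c.LocalRing := algebraMap K[X] c.LocalRing Polynomial.X

/-- The local homomorphism `φ^*` from the local ring at `φ(P)` to the local ring at `P`. -/
def pull : c.LocalRing →+* P.ring :=
  IsLocalization.lift (M := c.image.primeCompl)
    (g := (Polynomial.aeval c.φ : K[X] →ₐ[K] P.ring).toRingHom)
    fun q => by
      by_contra h
      exact q.2 ((IsLocalRing.mem_maximalIdeal _).2 h)

end NisnevichCoordinate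

/-- The Scheja–Storch map `Θ : Hom(Q, K) → Q` of an element `Δ` of `Q ⊗ Q`; for `Δ = b ⊗ c` it
sends `μ` to `μ(b) c`. -/
def schejaStorch {Q : Type u} [CommRing Q] [Algebra K Q] (Δ : Q ⊗[K] Q) (μ : Q →ₗ[K] K) : Q :=
  TensorProduct.lid K Q (LinearMap.rTensor Q μ Δ)

/-- The choices made in computing the local index at `P` of a section `σ` of a relatively oriented
line bundle `L`, for a given order `N` of approximation. -/
structure IndexData {L : CurveSheaf K F} (o : L.RelativeOrientation) (σ : L.gen)
    (P : Point K F) (N : ℕ) where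
  coord : NisnevichCoordinate P
  /-- The local trivialization of the tangent sheaf given by the coordinate: `∂φ`, dual to
  `dφ`. -/
  d : (CurveSheaf.tangent K F).gen
  d_apply : (show Ω[F⁄K] →ₗ[F] F from d) (KaehlerDifferential.D K F (coord.φ : F)) = (1 : F)
  /-- The local trivialization of `L`. -/
  e : L.gen
  stalk_eq : L.stalk P = Submodule.span P.ring {e}
  /-- Compatibility with the relative orientation: the local section `∂φ ↦ e` of `Hom(T C, L)`
  is the square `s ⊗ s` of a local generator `s` of `M`. -/
  s : o.M.gen
  stalk_M_eq : o.M.stalk P = Submodule.span P.ring {s}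
  compatible : (show (CurveSheaf.tangent K F).gen →ₗ[F] L.gen from o.iso (s ⊗ₜ[F] s)) d = e
  /-- The function to which `σ` corresponds in the trivialization. -/
  f : P.ring
  section_eq : σ = f • e
  /-- A function on the affine line near `φ(P)` that agrees with `f` up to order `N`. -/
  G : coord.LocalRing
  approx : coord.pull G - f ∈ P.max ^ N
  a : coord.LocalRing ⊗[K] coord.LocalRing
  a_eq : G ⊗ₜ[K] (1 : coord.LocalRing) - (1 : coord.LocalRing) ⊗ₜ[K] G =
    a * (coord.X ⊗ₜ[K] (1 : coord.LocalRing) - (1 : coord.LocalRing) ⊗ₜ[K] coord.X)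
  η : (coord.LocalRing ⧸ Ideal.span {G}) →ₗ[K] K
  /-- `η = Θ⁻¹(1)`. -/
  η_eq : schejaStorch (K := K) (Q := coord.LocalRing ⧸ Ideal.span {G})
    (Algebra.TensorProduct.map (Ideal.Quotient.mkₐ K (Ideal.span {G}))
      (Ideal.Quotient.mkₐ K (Ideal.span {G})) a) η = 1

/-- The class of the Scheja–Storch form `(b, c) ↦ η(bc)` on `Q`. -/
def IndexData.formClass {L : CurveSheaf K F} {o : L.RelativeOrientation} {σ : L.gen}
    {P : Point K F} {N : ℕ} (D : IndexData o σ P N) : GW K :=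
  GW.ofForm ((LinearMap.mul K (D.coord.LocalRing ⧸ Ideal.span {D.G})).compr₂ D.η)

/-- The local index `ind_P σ` exists and is equal to `γ`: for all sufficiently large `N` the
choices in its computation can be made, and all of them lead to the class `γ`. -/
def HasLocalIndex {L : CurveSheaf K F} (o : L.RelativeOrientation) (σ : L.gen)
    (P : Point K F) (γ : GW K) : Prop :=
  ∀ᶠ N : ℕ in Filter.atTop, Nonempty (IndexData o σ P N) ∧
    ∀ D : IndexData o σ P N, D.formClass = γ

open Classical in
/-- The local index `ind_P σ` (the junk value `0` if it does not exist). -/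
def localIndex {L : CurveSheaf K F} (o : L.RelativeOrientation) (σ : L.gen)
    (P : Point K F) : GW K :=
  if h : ∃ γ, HasLocalIndex o σ P γ then h.choose else 0

end Curve

/-! ### Maps of curves

A nonconstant map `f : Y → X` of regular projective curves over `K` is given by the homomorphism
`FX → FY` of their function fields. -/

section Map

variable {K FX FY : Type u} [Field K] [Field FX] [Field FY] [Algebra K FX] [Algebra K FY]

/-- The image of a point under the map of curves. -/
def Point.map (f : FX →ₐ[K] FY) (P : Point K FY) : Point K FX where
  ring := P.ring.comap f.toRingHom
  algebraMap_mem c := by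
    have h := P.algebraMap_mem c
    rw [← f.commutes] at h
    exact h

/-- The degree `[K(Y) : K(X)]`. -/
def mapDegree (f : FX →ₐ[K] FY) : ℕ :=
  letI : Algebra FX FY := f.toRingHom.toAlgebra
  Module.finrank FX FY

/-- The pullback of a sheaf. -/
def CurveSheaf.pullback (f : FX →ₐ[K] FY) (L : CurveSheaf K FX) : CurveSheaf K FY :=
  letI : Algebra FX FY := f.toRingHom.toAlgebra
  { gen := FY ⊗[FX] L.gen
    stalk := fun P => Submodule.span P.ring
      {t | ∃ x ∈ L.stalk (P.map f), t = (1 : FY) ⊗ₜ[FX] x} }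

/-- The sheaf `Hom(f^* T^∨ X, T^∨ Y)`. -/
def differentialSheaf (f : FX →ₐ[K] FY) : CurveSheaf K FY :=
  ((CurveSheaf.cotangent K FX).pullback f).hom (CurveSheaf.cotangent K FY)

/-- The section `df` of `Hom(f^* T^∨ X, T^∨ Y)`; it sends `f^*(dx)` to `d(f^* x)`. -/
def differential (f : FX →ₐ[K] FY) : (differentialSheaf f).gen :=
  letI : Algebra FX FY := f.toRingHom.toAlgebra
  haveI : IsScalarTower K FX FY := .of_algebraMap_eq fun c => (f.commutes c).symm
  KaehlerDifferential.mapBaseChange K FX FY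

/-- The zeros of `df`. -/
def ramificationPoints (f : FX →ₐ[K] FY) : Set (Point K FY) :=
  {P | (differentialSheaf f).Vanishes (differential f) P}

/-- The enriched Riemann–Hurwitz formula
`χ(Y) = deg f · χ(X) - ∑_{df(P) = 0} ind_P df` in `GW K`. -/
def EnrichedRiemannHurwitz (f : FX →ₐ[K] FY) (o : (differentialSheaf f).RelativeOrientation) :
    Prop :=
  eulerChar K FY =
    mapDegree f • eulerChar K FX - ∑ᶠ P ∈ ramificationPoints f, localIndex o (differential f) P

end Map

/-! ### The projective line and the Artin–Schreier map -/

open Classical in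
/-- The point at infinity of the projective line with affine coordinate `RatFunc.X`. -/
def infinity (K : Type u) [Field K] : Point K (RatFunc K) where
  ring := (RatFunc.inftyValuation K).valuationSubring
  algebraMap_mem c := by
    rw [Valuation.mem_valuationSubring_iff]
    by_cases hc : c = 0
    · simp [hc]
    · exact (RatFunc.inftyValuation.C K hc).le

theorem transcendental_artinSchreier (K : Type u) [Field K] (p : ℕ) [hp : Fact p.Prime] :
    Transcendental K (RatFunc.X ^ p - RatFunc.X : RatFunc K) := by
  apply RatFunc.transcendental_of_ne_C
  rintro ⟨c, hc⟩
  have h : (Polynomial.X ^ p - Polynomial.X : K[X]) = Polynomial.C c := by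
    apply RatFunc.algebraMap_injective K
    simpa using hc
  have h' := congrArg (Polynomial.coeff · p) h
  simp [Polynomial.coeff_X, Polynomial.coeff_C, hp.out.one_lt.ne, hp.out.ne_zero] at h'

/-- The map `y ↦ y ^ p - y` from the projective line to itself, given by the homomorphism
`x ↦ y ^ p - y` of function fields. -/
def artinSchreier (K : Type u) [Field K] (p : ℕ) [Fact p.Prime] : RatFunc K →ₐ[K] RatFunc K :=
  RatFunc.liftAlgHom (Polynomial.aeval (RatFunc.X ^ p - RatFunc.X : RatFunc K))
    (nonZeroDivisors_le_comap_nonZeroDivisors_of_injective _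
      (transcendental_iff_injective.1 (transcendental_artinSchreier K p)))

theorem artinSchreier_X (K : Type u) [Field K] (p : ℕ) [Fact p.Prime] :
    artinSchreier K p RatFunc.X = RatFunc.X ^ p - RatFunc.X := by
  have h := RatFunc.liftAlgHom_apply_div'
    (φ := Polynomial.aeval (RatFunc.X ^ p - RatFunc.X : RatFunc K))
    (nonZeroDivisors_le_comap_nonZeroDivisors_of_injective _
      (transcendental_iff_injective.1 (transcendental_artinSchreier K p))) Polynomial.X 1
  simpa [artinSchreier] using h

end EnrichedRH

end

/-! In characteristic `p` one has `d(y ^ p - y) = -dy`, so `df` generates `Hom(f^*T^∨X, T^∨Y)`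
wherever `y` is regular. At infinity put `w = 1/y` and `u = 1 - w ^ (p - 1)`. Then `1/x` pulls back
to `w ^ p * u⁻¹`, and its differential is `-w ^ (2 * (p - 1)) * u⁻² dw`. The ramification is wild,
and `df` has a zero of order `2 * (p - 1)` there and no other zero
(`isLocalGenerator_differential_of_mem`, `isLocalGenerator_differential_of_notMem`). Hence `Hom(TY,
𝒱)` has even degree `2 * (p - 2)` and is the square of the bundle of degree `p - 2`, which gives the
orientation (`exists_relativeOrientation`).

The index does not depend on choices because it is forced to be hyperbolic. For `N > 2 * m` with `m
= p - 1`, every admissible `G` still has order `2 * m`, so `Q ≅ K[t]/(t ^ (2 * m))`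
(`NisnevichCoordinate.isTruncatedBy`). The image of `a` in `Q ⊗ Q` is killed by `x ⊗ 1 - 1 ⊗ x`, so
`Θ` is `Q`-linear and `Θ(η) = 1` makes `(b, c) ↦ η(bc)` nondegenerate, whatever `η` is. The ideal
`(t ^ m)` has square zero and half the dimension, so as `2` is invertible the form is `m • h`
(`GW.ofForm_eq_smul_hyp`, `IndexData.formClass_eq`). The standard choice `G = X ^ (2 * m)` shows
that index data exist (`nonempty_indexData`).

Both curves have genus `0` and `f` has degree `p`, so Riemann–Hurwitz reads `h = p • h - (p - 1) •
h`. -/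

noncomputable section

namespace EnrichedRH

universe u

/-! ### Multiples of a form, and splitting into hyperbolic planes -/

namespace SymForm

variable {K : Type u} [Field K]

/-- The orthogonal sum of `m` copies of a bilinear form. -/
def powerForm {V : Type u} [AddCommGroup V] [Module K V] (B : LinearMap.BilinForm K V) (m : ℕ) :
    LinearMap.BilinForm K (Fin m → V) :=
  ∑ i, B.comp (LinearMap.proj i) (LinearMap.proj i)

theorem powerForm_apply {V : Type u} [AddCommGroup V] [Module K V] (B : LinearMap.BilinForm K V)
    (m : ℕ) (x y : Fin m → V) : powerForm B m x y = ∑ i, B (x i) (y i) := by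
  simp [powerForm, LinearMap.sum_apply]

theorem powerForm_nondegenerate {V : Type u} [AddCommGroup V] [Module K V]
    {B : LinearMap.BilinForm K V} (hB : B.Nondegenerate) (m : ℕ) :
    (powerForm B m).Nondegenerate := by
  refine ⟨fun x hx => funext fun i => hB.1 _ fun v => ?_,
    fun x hx => funext fun i => hB.2 _ fun v => ?_⟩
  · have := hx (Pi.single i v)
    rw [powerForm_apply, Finset.sum_eq_single i (fun j _ h => by simp [h]) (by simp)] at this
    simpa using this
  · have := hx (Pi.single i v)
    rw [powerForm_apply, Finset.sum_eq_single i (fun j _ h => by simp [h]) (by simp)] at this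
    simpa using this

/-- The orthogonal sum of `m` copies of a nondegenerate symmetric form. -/
def power (B : SymForm K) (m : ℕ) : SymForm K where
  V := Fin m → B.V
  form := powerForm B.form m
  symm := ⟨fun x y => by simp [powerForm_apply, B.symm.eq]⟩
  nondeg := powerForm_nondegenerate B.nondeg m

/-- The isometry class of a form. -/
abbrev toClass (B : SymForm K) : FormClass K := Quotient.mk (setoid K) B

theorem toClass_power (B : SymForm K) (m : ℕ) : (B.power m).toClass = m • B.toClass := by
  induction m with
  | zero =>
    rw [zero_smul]
    exact Quotient.sound ⟨⟨LinearEquiv.ofSubsingleton (Fin 0 → B.V) PUnit.{u + 1},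
      fun x y => (powerForm_apply B.form 0 x y).symm⟩⟩
  | succ m ih =>
    rw [succ_nsmul', ← ih]
    exact Quotient.sound ⟨⟨(Fin.consLinearEquiv K fun _ : Fin (m + 1) => B.V).symm,
      fun x y => ((powerForm_apply B.form (m + 1) x y).trans (Fin.sum_univ_succ _)).trans
        (congrArg (B.form (x 0) (y 0) + ·)
          (powerForm_apply B.form m (fun i => x i.succ) fun i => y i.succ).symm) |>.symm⟩⟩

end SymForm

/-- Over a field of characteristic different from `2`, a nondegenerate symmetric form with an
isotropic subspace of half the dimension is an orthogonal sum of hyperbolic planes. -/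
theorem GW.ofForm_eq_smul_hyp {K : Type u} [Field K] (h2 : (2 : K) ≠ 0) {V : Type u}
    [AddCommGroup V] [Module K V] [Module.Finite K V] {B : LinearMap.BilinForm K V}
    (hs : B.IsSymm) (hn : B.Nondegenerate) {m : ℕ} (hV : Module.finrank K V = 2 * m)
    {L : Submodule K V} (hL : Module.finrank K L = m) (hiso : ∀ x ∈ L, ∀ y ∈ L, B x y = 0) :
    GW.ofForm B = m • GW.hyp K := by
  obtain ⟨b⟩ : Nonempty (Module.Basis (Fin m) K L) := ⟨Module.finBasisOfFinrankEq K L hL⟩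
  -- Vectors dual to the basis of `L`: extend each coordinate functional to `V` and represent it
  -- through the nondegenerate form.
  have hdual (i : Fin m) : ∃ e : V, ∀ j, B (b j) e = if j = i then 1 else 0 := by
    obtain ⟨g, hg⟩ := LinearMap.exists_extend (b.coord i)
    have hnB : LinearMap.BilinForm.Nondegenerate B := hn
    refine ⟨(B.toDual hnB).symm g, fun j => ?_⟩
    rw [← hs.eq, LinearMap.BilinForm.apply_toDual_symm_apply]
    have := LinearMap.congr_fun hg (b j)
    simp only [LinearMap.comp_apply, Submodule.subtype_apply] at this
    rw [this]
    simp [Finsupp.single_apply]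
  choose e he using hdual
  have he' (i j : Fin m) : B (e i) (b j) = if j = i then 1 else 0 := by rw [← he, hs.eq]
  have hb (i j : Fin m) : B (b i) (b j) = 0 := hiso _ (b i).2 _ (b j).2
  -- Subtracting half of the Gram matrix along `L` makes the dual vectors span an isotropic
  -- complement, without changing their pairing with `L`.
  let e' : Fin m → V := fun i => e i - (2 : K)⁻¹ • ∑ j, B (e i) (e j) • (b j : V)
  have hbe (i j : Fin m) : B (b i) (e' j) = if i = j then 1 else 0 := by
    simp [e', he, hb]
  have heb (i j : Fin m) : B (e' i) (b j) = if j = i then 1 else 0 := by rw [← hbe, hs.eq]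
  have hee (i j : Fin m) : B (e' i) (e' j) = 0 := by
    have : B (e' i) (e j) = (2 : K)⁻¹ * B (e i) (e j) := by
      simp [e', he]
      field_simp; ring
    have h1 : B (e' i) (e' j) = B (e' i) (e j) - (2 : K)⁻¹ * B (e j) (e i) := by
      conv_lhs => rw [show e' j = e j - (2 : K)⁻¹ • ∑ l, B (e j) (e l) • (b l : V) from rfl]
      simp [heb]
    rw [h1, this, ← hs.eq (e i) (e j)]
    simp
  let H : SymForm K := (SymForm.rankOne 1).add (SymForm.rankOne (-1))
  let C : LinearMap.BilinForm K (K × K) := H.form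
  have hH (x y : K × K) : C x y = x.1 * y.1 - x.2 * y.2 := by
    refine (SymForm.orthSum_apply _ _ x y).trans ?_
    change ((1 : Kˣ) : K) * (x.1 * y.1) + ((-1 : Kˣ) : K) * (x.2 * y.2) = _
    simp [sub_eq_add_neg]
  -- The vectors `b ± e' / 2` have norms `1` and `-1` and are orthogonal, so they span a copy of
  -- `⟨1⟩ + ⟨-1⟩`.
  let T (i : Fin m) : K × K →ₗ[K] V :=
    (LinearMap.toSpanSingleton K V ((b i : V) + (2 : K)⁻¹ • e' i)).coprod
      (LinearMap.toSpanSingleton K V ((b i : V) - (2 : K)⁻¹ • e' i))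
  have hT (i j : Fin m) (x y : K × K) : B (T i x) (T j y) = if i = j then C x y else 0 := by
    simp only [T, LinearMap.coprod_apply, LinearMap.toSpanSingleton_apply, map_add, map_smul,
      LinearMap.add_apply, LinearMap.smul_apply, map_sub, LinearMap.sub_apply, hb, hbe, heb, hee,
      eq_comm (a := j), hH, smul_eq_mul]
    split_ifs
    · field_simp; ring
    · simp
  let S : (Fin m → K × K) →ₗ[K] V := LinearMap.lsum K (fun _ => K × K) K T
  have hS (x y : Fin m → K × K) : B (S x) (S y) = SymForm.powerForm C m x y := by
    rw [SymForm.powerForm_apply]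
    simp [S, LinearMap.lsum_apply, LinearMap.sum_apply, hT]
  have hinj : Function.Injective S := by
    rw [← LinearMap.ker_eq_bot, LinearMap.ker_eq_bot']
    intro x hx
    refine (SymForm.powerForm_nondegenerate (B := C) H.nondeg m).1 x fun y => ?_
    rw [← hS, hx]; simp
  have hdim : Module.finrank K (Fin m → K × K) = Module.finrank K V := by
    rw [hV]; simp [Module.finrank_pi_fintype, mul_comm]
  let E : (Fin m → K × K) ≃ₗ[K] V := LinearEquiv.ofBijective S
    ⟨hinj, (LinearMap.injective_iff_surjective_of_finrank_eq_finrank hdim).1 hinj⟩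
  rw [GW.ofForm, dif_pos ⟨inferInstance, hs, hn⟩]
  have hcls : SymForm.toClass { V := V, form := B, symm := hs, nondeg := hn } =
      (H.power m).toClass := Quotient.sound (Setoid.symm ⟨⟨E, hS⟩⟩)
  refine (congrArg Algebra.GrothendieckAddGroup.of (hcls.trans (H.toClass_power m))).trans ?_
  rw [map_nsmul]
  exact congrArg (m • ·) (map_add Algebra.GrothendieckAddGroup.of
    (SymForm.rankOne 1).toClass (SymForm.rankOne (-1)).toClass)

/-! ### Truncated polynomial algebras -/

/-- `t` generates the local `K`-algebra `A` with residue field `K`, and has nilpotency order `n`;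
thus `A ≅ K[t]/(t ^ n)`. -/
structure IsTruncatedBy (K : Type u) [Field K] {A : Type u} [CommRing A] [Algebra K A] (t : A)
    (n : ℕ) : Prop where
  pos : 0 < n
  pow_eq_zero : t ^ n = 0
  pow_pred_ne_zero : t ^ (n - 1) ≠ 0
  exists_eq : ∀ q : A, ∃ (c : K) (r : A), q = algebraMap K A c + t * r

namespace IsTruncatedBy

variable {K : Type u} [Field K] {A : Type u} [CommRing A] [Algebra K A] {t : A} {n : ℕ}

/-- If `i` is the least index with nonzero coefficient in a relation, multiplication by `t ^ (n - 1
- i)` kills every other term and leaves a nonzero multiple of `t ^ (n - 1)`. -/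
theorem linearIndependent (h : IsTruncatedBy K t n) :
    LinearIndependent K fun i : Fin n => t ^ (i : ℕ) := by
  rw [Fintype.linearIndependent_iff]
  intro g hg
  by_contra! hne
  obtain ⟨i, hi, hmin⟩ := WellFounded.has_min (wellFounded_lt (α := Fin n))
    {i | g i ≠ 0} hne
  have h0 := congrArg (t ^ (n - 1 - i : ℕ) * ·) hg
  simp only [Finset.mul_sum, mul_zero] at h0
  rw [Finset.sum_eq_single i] at h0
  · rw [mul_smul_comm, ← pow_add, Nat.sub_add_cancel (by omega)] at h0
    exact (smul_ne_zero hi h.pow_pred_ne_zero) h0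
  · intro j _ hj
    rcases lt_or_gt_of_ne hj with hlt | hgt
    · have : g j = 0 := by
        by_contra hj0
        exact hmin j hj0 hlt
      simp [this]
    · rw [mul_smul_comm, ← pow_add, show (n - 1 - i + j : ℕ) = n + (j - i - 1) by omega, pow_add,
        h.pow_eq_zero]
      simp
  · simp

/-- Iterating `exists_eq` expands an element in powers of `t` up to a multiple of `t ^ j`; at `j =
n` the remainder vanishes. -/
theorem span_eq_top (h : IsTruncatedBy K t n) :
    Submodule.span K (Set.range fun i : Fin n => t ^ (i : ℕ)) = ⊤ := by
  have key (j : ℕ) (q : A) : ∃ s ∈ Submodule.span K (Set.range fun i : Fin n => t ^ (i : ℕ)),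
      ∃ r, q = s + t ^ j * r := by
    induction j with
    | zero => exact ⟨0, Submodule.zero_mem _, q, by simp⟩
    | succ j ih =>
      obtain ⟨s, hs, r, hr⟩ := ih
      obtain ⟨c, r', hr'⟩ := h.exists_eq r
      refine ⟨s + c • t ^ j, Submodule.add_mem _ hs (Submodule.smul_mem _ _ ?_), r', ?_⟩
      · by_cases hj : j < n
        · exact Submodule.subset_span ⟨⟨j, hj⟩, rfl⟩
        · rw [pow_eq_zero_of_le (not_lt.1 hj) h.pow_eq_zero]
          exact Submodule.zero_mem _
      · rw [hr, hr', Algebra.smul_def]; ring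
  rw [eq_top_iff]
  rintro q -
  obtain ⟨s, hs, r, hr⟩ := key n q
  rw [hr, h.pow_eq_zero, zero_mul, add_zero]
  exact hs

/-- The basis of powers of `t`. -/
def basis (h : IsTruncatedBy K t n) : Module.Basis (Fin n) K A :=
  Module.Basis.mk h.linearIndependent h.span_eq_top.ge

theorem basis_apply (h : IsTruncatedBy K t n) (i : Fin n) : h.basis i = t ^ (i : ℕ) := by
  simp [basis]

theorem finite (h : IsTruncatedBy K t n) : Module.Finite K A := .of_basis h.basis

theorem finrank_eq (h : IsTruncatedBy K t n) : Module.finrank K A = n := by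
  simpa using Module.finrank_eq_card_basis h.basis

theorem adjoin_eq_top (h : IsTruncatedBy K t n) : Algebra.adjoin K {t} = ⊤ := by
  rw [← Algebra.toSubmodule_eq_top, eq_top_iff, ← h.span_eq_top, Submodule.span_le]
  rintro _ ⟨i, rfl⟩
  exact Subalgebra.pow_mem _ (Algebra.self_mem_adjoin_singleton K t) _

end IsTruncatedBy

/-! ### Scheja–Storch forms -/

section SchejaStorch

variable {K : Type u} [Field K] {Q : Type u} [CommRing Q] [Algebra K Q]

theorem schejaStorch_tmul (b c : Q) (μ : Q →ₗ[K] K) :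
    schejaStorch (b ⊗ₜ[K] c) μ = μ b • c := by
  simp [schejaStorch]

theorem schejaStorch_sum {ι : Type*} (s : Finset ι) (Δ : ι → Q ⊗[K] Q) (μ : Q →ₗ[K] K) :
    schejaStorch (∑ i ∈ s, Δ i) μ = ∑ i ∈ s, schejaStorch (Δ i) μ := by
  simp [schejaStorch]

/-- With `schejaStorch_mul_left` this gives `Q`-linearity of `Θ`: the second factor acts on values,
the first on functionals. -/
theorem schejaStorch_mul_right (Δ : Q ⊗[K] Q) (q : Q) (μ : Q →ₗ[K] K) :
    schejaStorch ((1 ⊗ₜ[K] q) * Δ) μ = q * schejaStorch Δ μ := by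
  induction Δ with
  | zero => simp [schejaStorch]
  | tmul b c => simp [schejaStorch_tmul]
  | add x y hx hy =>
    simp only [schejaStorch, mul_add, map_add] at *
    rw [hx, hy]

theorem schejaStorch_mul_left (Δ : Q ⊗[K] Q) (q : Q) (μ : Q →ₗ[K] K) :
    schejaStorch ((q ⊗ₜ[K] 1) * Δ) μ = schejaStorch Δ (μ ∘ₗ LinearMap.mulLeft K q) := by
  induction Δ with
  | zero => simp [schejaStorch]
  | tmul b c => simp [schejaStorch_tmul]
  | add x y hx hy =>
    simp only [schejaStorch, mul_add, map_add] at *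
    rw [hx, hy]

/-- If `Δ` is annihilated by the differences `q ⊗ 1 - 1 ⊗ q`, then `Θ` is `Q`-linear, so that a
functional `η` with `Θ(η) = 1` defines a nondegenerate form. -/
theorem nondegenerate_of_schejaStorch_eq_one {x : Q} (hx : Algebra.adjoin K {x} = ⊤)
    {Δ : Q ⊗[K] Q} (hΔ : (x ⊗ₜ[K] 1) * Δ = (1 ⊗ₜ[K] x) * Δ) {η : Q →ₗ[K] K}
    (hη : schejaStorch Δ η = 1) : ((LinearMap.mul K Q).compr₂ η).Nondegenerate := by
  have hΔ' (q : Q) : (q ⊗ₜ[K] 1) * Δ = (1 ⊗ₜ[K] q) * Δ := by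
    have hq : q ∈ Algebra.adjoin K {x} := hx ▸ Algebra.mem_top
    induction hq using Algebra.adjoin_induction with
    | mem y hy => rw [Set.mem_singleton_iff.1 hy, hΔ]
    | algebraMap r => rw [Algebra.algebraMap_eq_smul_one, TensorProduct.smul_tmul]
    | add a b _ _ ha hb => rw [TensorProduct.add_tmul, TensorProduct.tmul_add, add_mul, add_mul,
        ha, hb]
    | mul a b _ _ ha hb =>
      rw [show (a * b) ⊗ₜ[K] (1 : Q) = a ⊗ₜ[K] 1 * b ⊗ₜ[K] 1 by simp,
        show (1 : Q) ⊗ₜ[K] (a * b) = (1 ⊗ₜ[K] a) * (1 ⊗ₜ[K] b) by simp, mul_assoc, hb,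
        mul_left_comm, ha, mul_left_comm, mul_assoc]
  -- By linearity `q = q * Θ(η) = Θ(η(q ·)) = Θ(0) = 0`.
  have key (q : Q) (hq : ∀ r, η (q * r) = 0) : q = 0 := by
    have h0 : η ∘ₗ LinearMap.mulLeft K q = 0 := LinearMap.ext fun r => by simpa using hq r
    rw [← mul_one q, ← hη, ← schejaStorch_mul_right, ← hΔ', schejaStorch_mul_left, h0]
    simp [schejaStorch]
  exact ⟨fun q hq => key q fun r => by simpa using hq r,
    fun q hq => key q fun r => by simpa [mul_comm] using hq r⟩

/-- The Scheja–Storch form on `K[t]/(t ^ (2 * m))` is hyperbolic. -/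
theorem ofForm_eq_of_isTruncatedBy (h2 : (2 : K) ≠ 0) {t : Q} {m : ℕ}
    (h : IsTruncatedBy K t (2 * m)) {x : Q} (hx : Algebra.adjoin K {x} = ⊤)
    {Δ : Q ⊗[K] Q} (hΔ : (x ⊗ₜ[K] 1) * Δ = (1 ⊗ₜ[K] x) * Δ) {η : Q →ₗ[K] K}
    (hη : schejaStorch Δ η = 1) :
    GW.ofForm ((LinearMap.mul K Q).compr₂ η) = m • GW.hyp K := by
  have := h.finite
  have hli : LinearIndependent K fun i : Fin m => t ^ (m + i : ℕ) :=
    h.linearIndependent.comp (fun i : Fin m => (⟨m + i, by omega⟩ : Fin (2 * m)))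
      fun i j hij => by simpa [Fin.ext_iff] using hij
  refine GW.ofForm_eq_smul_hyp h2 ⟨fun a b => by simp [mul_comm]⟩
    (nondegenerate_of_schejaStorch_eq_one hx hΔ hη) h.finrank_eq
    (L := Submodule.span K (Set.range fun i : Fin m => t ^ (m + i : ℕ)))
    (by simpa using finrank_span_eq_card hli) ?_
  -- The chosen subspace lies in the ideal `(t ^ m)`, where products are multiples of `t ^ (2 * m) =
  -- 0`.
  have hsub (a : Q) (ha : a ∈ Submodule.span K (Set.range fun i : Fin m => t ^ (m + i : ℕ))) :
      ∃ r, a = t ^ m * r := by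
    induction ha using Submodule.span_induction with
    | mem a ha => obtain ⟨i, rfl⟩ := ha; exact ⟨_, pow_add _ _ _⟩
    | zero => exact ⟨0, by simp⟩
    | add a b _ _ ha hb =>
      obtain ⟨r, rfl⟩ := ha
      obtain ⟨s, rfl⟩ := hb
      exact ⟨r + s, by ring⟩
    | smul c a _ ha =>
      obtain ⟨r, rfl⟩ := ha
      exact ⟨c • r, by simp⟩
  intro a ha b hb
  obtain ⟨r, rfl⟩ := hsub a ha
  obtain ⟨s, rfl⟩ := hsub b hb
  have : t ^ m * r * (t ^ m * s) = 0 := by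
    rw [show t ^ m * r * (t ^ m * s) = t ^ (2 * m) * (r * s) by ring, h.pow_eq_zero, zero_mul]
  simp [this]

/-- The functional `Θ⁻¹(1)` for the Bézoutian of `t ^ n`. -/
theorem schejaStorch_geom_sum_coord {t : Q} {n : ℕ} (h : IsTruncatedBy K t n) :
    schejaStorch (∑ i ∈ Finset.range n, (t ^ i) ⊗ₜ[K] (t ^ (n - 1 - i)))
      (h.basis.coord ⟨n - 1, Nat.sub_lt h.pos one_pos⟩) = 1 := by
  simp_rw [schejaStorch_sum, schejaStorch_tmul]
  rw [Finset.sum_eq_single_of_mem (n - 1) (Finset.mem_range.2 (Nat.sub_lt h.pos one_pos))]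
  · rw [← h.basis_apply ⟨n - 1, Nat.sub_lt h.pos one_pos⟩]
    simp
  · intro i hi hne
    rw [← h.basis_apply ⟨i, Finset.mem_range.1 hi⟩]
    simp [hne]

end SchejaStorch

/-! ### Linear algebra for the generic stalks of line bundles -/

section OneDimensional

variable {F V W : Type*} [Field F] [AddCommGroup V] [Module F V] [AddCommGroup W] [Module F W]

theorem exists_linearMap_apply_eq {v : V} (hv : v ≠ 0) (w : W) : ∃ φ : V →ₗ[F] W, φ v = w := by
  obtain ⟨g, hg⟩ := LinearMap.exists_leftInverse_of_injective (LinearMap.toSpanSingleton F V v)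
    (LinearMap.ker_toSpanSingleton F hv)
  refine ⟨LinearMap.toSpanSingleton F W w ∘ₗ g, ?_⟩
  have h1 := LinearMap.congr_fun hg 1
  simp only [LinearMap.comp_apply, LinearMap.toSpanSingleton_apply, one_smul] at h1
  simp [h1]

theorem tmul_ne_zero {v : V} (hv : v ≠ 0) {w : W} (hw : w ≠ 0) : v ⊗ₜ[F] w ≠ 0 := by
  obtain ⟨f, hf⟩ := exists_linearMap_apply_eq (F := F) hv (1 : F)
  obtain ⟨g, hg⟩ := exists_linearMap_apply_eq (F := F) hw (1 : F)
  intro h0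
  have := congrArg (LinearMap.mul' F F ∘ₗ TensorProduct.map f g) h0
  simp [hf, hg] at this

theorem exists_eq_smul_tmul {v : V} (hv : ∀ x : V, ∃ a : F, x = a • v) {w : W}
    (hw : ∀ x : W, ∃ a : F, x = a • w) (x : V ⊗[F] W) : ∃ a : F, x = a • v ⊗ₜ[F] w := by
  induction x with
  | zero => exact ⟨0, (zero_smul F _).symm⟩
  | tmul x y =>
    obtain ⟨a, rfl⟩ := hv x
    obtain ⟨b, rfl⟩ := hw y
    exact ⟨a * b, TensorProduct.smul_tmul_smul _ _ _ _⟩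
  | add x y hx hy =>
    obtain ⟨a, ha⟩ := hx
    obtain ⟨b, hb⟩ := hy
    exact ⟨a + b, by rw [ha, hb, add_smul]⟩

end OneDimensional

/-! ### Calculus of local generators of line bundles -/

section LocalGenerators

variable {K F : Type u} [Field K] [Field F] [Algebra K F]

theorem Point.smul_def {M : Type*} [AddCommGroup M] [Module F M] (P : Point K F) (a : P.ring)
    (x : M) : a • x = (a : F) • x := rfl

theorem Point.coe_aeval (P : Point K F) (z : P.ring) (q : K[X]) :
    ((Polynomial.aeval z q : P.ring) : F) = Polynomial.aeval (z : F) q := by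
  have h := Polynomial.aeval_algebraMap_apply F z q
  exact h.symm

theorem Point.aeval_mem (P : Point K F) {z : F} (hz : z ∈ P.ring) (q : K[X]) :
    Polynomial.aeval z q ∈ P.ring := by
  rw [← P.coe_aeval ⟨z, hz⟩ q]
  exact Subtype.property _

namespace CurveSheaf

/-- `e` generates the stalk of `L` at `P`, and is a basis of the generic stalk. -/
structure IsLocalGenerator (L : CurveSheaf K F) (P : Point K F) (e : L.gen) : Prop where
  ne_zero : e ≠ 0
  exists_smul : ∀ x : L.gen, ∃ a : F, x = a • e
  stalk_eq : L.stalk P = Submodule.span P.ring {e}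

namespace IsLocalGenerator

variable {L L' : CurveSheaf K F} {P : Point K F} {e : L.gen} {e' : L'.gen}

theorem smul_mem_iff (h : L.IsLocalGenerator P e) (a : F) : a • e ∈ L.stalk P ↔ a ∈ P.ring := by
  rw [h.stalk_eq, Submodule.mem_span_singleton]
  constructor
  · rintro ⟨b, hb⟩
    rw [Point.smul_def] at hb
    rw [← smul_left_injective F h.ne_zero hb]
    exact b.2
  · exact fun ha => ⟨⟨a, ha⟩, rfl⟩

theorem self_mem (h : L.IsLocalGenerator P e) : e ∈ L.stalk P := by
  rw [h.stalk_eq]; exact Submodule.mem_span_singleton_self e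

theorem of_smul_mem_iff (h0 : e ≠ 0) (hs : ∀ x : L.gen, ∃ a : F, x = a • e)
    (h : ∀ a : F, a • e ∈ L.stalk P ↔ a ∈ P.ring) : L.IsLocalGenerator P e := by
  refine ⟨h0, hs, ?_⟩
  ext x
  obtain ⟨a, rfl⟩ := hs x
  rw [h, Submodule.mem_span_singleton]
  constructor
  · exact fun ha => ⟨⟨a, ha⟩, rfl⟩
  · rintro ⟨b, hb⟩
    rw [Point.smul_def] at hb
    rw [← smul_left_injective F h0 hb]
    exact b.2

/-- Meant for the stalks that are defined as spans: those of cotangent sheaves, tensor products and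
pullbacks. -/
theorem of_span {S : Set L.gen} (hS : L.stalk P = Submodule.span P.ring S) (h0 : e ≠ 0)
    (hs : ∀ x : L.gen, ∃ a : F, x = a • e) (he : e ∈ S)
    (h : ∀ x ∈ S, ∃ b ∈ P.ring, x = b • e) : L.IsLocalGenerator P e := by
  refine ⟨h0, hs, hS.trans (le_antisymm (Submodule.span_le.2 fun x hx => ?_)
    (Submodule.span_mono (Set.singleton_subset_iff.2 he)))⟩
  obtain ⟨b, hb, rfl⟩ := h x hx
  exact Submodule.mem_span_singleton.2 ⟨⟨b, hb⟩, rfl⟩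

theorem exists_smul_of_mem_span (h : L.IsLocalGenerator P e) {S : Set L.gen}
    (hS : L.stalk P = Submodule.span P.ring S) {x : L.gen} (hx : x ∈ S) :
    ∃ b : P.ring, x = (b : F) • e := by
  have hx' : x ∈ L.stalk P := hS ▸ Submodule.subset_span hx
  obtain ⟨a, rfl⟩ := h.exists_smul x
  exact ⟨⟨a, (h.smul_mem_iff a).1 hx'⟩, rfl⟩

theorem of_stalk_eq (h : L.IsLocalGenerator P e) {e₁ : L.gen}
    (h₁ : L.stalk P = Submodule.span P.ring {e₁}) : L.IsLocalGenerator P e₁ := by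
  have he : e ∈ Submodule.span P.ring {e₁} := h₁ ▸ h.self_mem
  obtain ⟨b, hb⟩ := Submodule.mem_span_singleton.1 he
  refine ⟨fun h0 => h.ne_zero (by rw [← hb, h0, smul_zero]), fun x => ?_, h₁⟩
  obtain ⟨a, rfl⟩ := h.exists_smul x
  exact ⟨a * b, by rw [← hb, Point.smul_def, smul_smul]⟩

theorem exists_unit_smul (h : L.IsLocalGenerator P e) {e₁ : L.gen}
    (h₁ : L.IsLocalGenerator P e₁) : ∃ u : P.ringˣ, e₁ = ((u : P.ring) : F) • e := by
  obtain ⟨a, ha⟩ := h.exists_smul e₁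
  obtain ⟨b, hb⟩ := h₁.exists_smul e
  have hab : a * b = 1 := smul_left_injective F h₁.ne_zero (by
    simp only [one_smul]
    rw [mul_smul, ← hb, ← ha])
  have haP : a ∈ P.ring := (h.smul_mem_iff a).1 (ha ▸ h₁.self_mem)
  have hbP : b ∈ P.ring := (h₁.smul_mem_iff b).1 (hb ▸ h.self_mem)
  exact ⟨⟨⟨a, haP⟩, ⟨b, hbP⟩, Subtype.ext hab, Subtype.ext ((mul_comm b a).trans hab)⟩, ha⟩

theorem unit_smul (h : L.IsLocalGenerator P e) {c : F} (hc : c ∈ P.ring) (hc' : c⁻¹ ∈ P.ring)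
    (h0 : c ≠ 0) : L.IsLocalGenerator P (c • e) := by
  refine of_smul_mem_iff (smul_ne_zero h0 h.ne_zero) (fun x => ?_) fun a => ?_
  · obtain ⟨a, rfl⟩ := h.exists_smul x
    exact ⟨a * c⁻¹, by rw [smul_smul, inv_mul_cancel_right₀ h0]⟩
  · rw [smul_smul, h.smul_mem_iff]
    refine ⟨fun ha => ?_, fun ha => mul_mem ha hc⟩
    simpa [h0] using mul_mem ha hc'

/-- A linear map on the generic stalk is determined by its value at `e`, and it preserves stalks
exactly when that value lies in the stalk of `L'`. -/
theorem hom (h : L.IsLocalGenerator P e) (h' : L'.IsLocalGenerator P e')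
    {φ : L.gen →ₗ[F] L'.gen} (hφ : φ e = e') : (L.hom L').IsLocalGenerator P φ := by
  refine of_smul_mem_iff (fun h0 => h'.ne_zero ?_) (fun (ψ : L.gen →ₗ[F] L'.gen) => ?_)
    fun a => ?_
  · rw [← hφ, show φ = 0 from h0, LinearMap.zero_apply]
  · obtain ⟨a, ha⟩ := h'.exists_smul (ψ e)
    refine ⟨a, LinearMap.ext fun x => ?_⟩
    obtain ⟨b, rfl⟩ := h.exists_smul x
    change ψ (b • e) = a • φ (b • e)
    rw [map_smul, map_smul, hφ, ha, smul_comm]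
  · rw [← h'.smul_mem_iff, ← hφ]
    refine ⟨fun ha => ha e h.self_mem, fun ha x hx => ?_⟩
    obtain ⟨b, rfl⟩ := h.exists_smul x
    rw [h.smul_mem_iff] at hx
    change a • φ (b • e) ∈ _
    rw [map_smul, smul_comm]
    exact (L'.stalk P).smul_mem (⟨b, hx⟩ : P.ring) ha

theorem tensor (h : L.IsLocalGenerator P e) (h' : L'.IsLocalGenerator P e') :
    (L.tensor L').IsLocalGenerator P (e ⊗ₜ[F] e') := by
  refine of_span rfl (tmul_ne_zero h.ne_zero h'.ne_zero)
    (exists_eq_smul_tmul h.exists_smul h'.exists_smul) ⟨e, h.self_mem, e', h'.self_mem, rfl⟩ ?_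
  rintro _ ⟨x, hx, y, hy, rfl⟩
  obtain ⟨a, rfl⟩ := h.exists_smul x
  obtain ⟨b, rfl⟩ := h'.exists_smul y
  exact ⟨a * b, mul_mem ((h.smul_mem_iff a).1 hx) ((h'.smul_mem_iff b).1 hy),
    TensorProduct.smul_tmul_smul _ _ _ _⟩

theorem structureSheaf (P : Point K F) :
    (CurveSheaf.structureSheaf K F).IsLocalGenerator P (1 : F) :=
  ⟨one_ne_zero (α := F), fun x : F => ⟨x, (mul_one x).symm⟩, rfl⟩

theorem vanishes_iff (h : L.IsLocalGenerator P e) (a : P.ring) :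
    L.Vanishes ((a : F) • e) P ↔ a ∈ P.max := by
  rw [Vanishes, h.stalk_eq, Submodule.mem_smul_span_singleton]
  constructor
  · rintro ⟨b, hb, hb'⟩
    rw [Point.smul_def] at hb'
    rwa [← Subtype.ext (smul_left_injective F h.ne_zero hb')]
  · exact fun ha => ⟨a, ha, rfl⟩

end IsLocalGenerator

end CurveSheaf

end LocalGenerators

/-! ### Differentials -/

section Differentials

variable {K F : Type u} [Field K] [Field F] [Algebra K F]

/-- Every element of `F` is a fraction of polynomials in `z`. -/
def GeneratesFractions (K : Type u) {F : Type u} [Field K] [Field F] [Algebra K F] (z : F) : Prop :=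
  ∀ g : F, ∃ a b : K[X], Polynomial.aeval z b ≠ 0 ∧ g = Polynomial.aeval z a / Polynomial.aeval z b

/-- Every element of a local ring that contains `z` is a fraction of polynomials in `z` whose
denominator is a unit in that local ring. -/
theorem GeneratesFractions.exists_fraction {z : F} (hz : GeneratesFractions K z) {P : Point K F}
    (hP : z ∈ P.ring) {g : F} (hg : g ∈ P.ring) :
    ∃ a b : K[X], Polynomial.aeval z b ≠ 0 ∧ (Polynomial.aeval z b)⁻¹ ∈ P.ring ∧
      Polynomial.aeval z b * g = Polynomial.aeval z a := by
  obtain ⟨a, b, hb, rfl⟩ := hz g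
  have hb0 : b ≠ 0 := by
    rintro rfl
    simp at hb
  obtain ⟨a', b', hcop, d, rfl, rfl⟩ : ∃ a' b', IsCoprime a' b' ∧ ∃ d, a = d * a' ∧ b = d * b' := by
    classical
    let := EuclideanDomain.gcdMonoid K[X]
    exact ⟨_, _, isCoprime_div_gcd_div_gcd hb0, EuclideanDomain.gcd a b,
      (EuclideanDomain.mul_div_cancel' (mt EuclideanDomain.gcd_eq_zero_iff.1 fun h => hb0 h.2)
        (EuclideanDomain.gcd_dvd_left a b)).symm,
      (EuclideanDomain.mul_div_cancel' (mt EuclideanDomain.gcd_eq_zero_iff.1 fun h => hb0 h.2)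
        (EuclideanDomain.gcd_dvd_right a b)).symm⟩
  have hbz : Polynomial.aeval z d ≠ 0 ∧ Polynomial.aeval z b' ≠ 0 := by
    rw [map_mul] at hb
    exact mul_ne_zero_iff.1 hb
  have hfrac : Polynomial.aeval z b' * (Polynomial.aeval z (d * a') / Polynomial.aeval z (d * b')) =
      Polynomial.aeval z a' := by
    rw [map_mul, map_mul, mul_div_mul_left _ _ hbz.1, mul_div_cancel₀ _ hbz.2]
  refine ⟨a', b', hbz.2, ?_, hfrac⟩
  -- Dividing the Bézout relation `u * a' + v * b' = 1` by `b'` gives `1 / b' = u * g + v` at `z`,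
  -- which lies in the local ring.
  obtain ⟨u, v, huv⟩ := hcop
  have h1 : Polynomial.aeval z b' * (Polynomial.aeval z u *
      (Polynomial.aeval z (d * a') / Polynomial.aeval z (d * b')) + Polynomial.aeval z v) = 1 := by
    rw [mul_add, mul_left_comm, hfrac, mul_comm _ (Polynomial.aeval z v), ← map_mul, ← map_mul,
      ← map_add, huv, map_one]
  rw [← eq_inv_of_mul_eq_one_right h1]
  exact add_mem (mul_mem (P.aeval_mem hP u) hg) (P.aeval_mem hP v)

/-- The quotient rule, in a form where only `b(z)` is inverted; when `b(z)` is a unit at a point,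
the coefficient is therefore regular there. -/
theorem exists_D_eq_smul {z : F} {a b : K[X]} {g : F} (hb : Polynomial.aeval z b ≠ 0)
    (h : Polynomial.aeval z b * g = Polynomial.aeval z a) :
    KaehlerDifferential.D K F g = ((Polynomial.aeval z b)⁻¹ *
      (Polynomial.aeval z (Polynomial.derivative a) -
        g * Polynomial.aeval z (Polynomial.derivative b))) • KaehlerDifferential.D K F z := by
  have h1 := congrArg (KaehlerDifferential.D K F) h
  rw [Derivation.leibniz, Derivation.map_aeval, Derivation.map_aeval, smul_smul] at h1
  rw [mul_smul, sub_smul, ← h1, add_sub_cancel_right, inv_smul_smul₀ hb]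

theorem GeneratesFractions.exists_eq_smul_D {z : F} (hz : GeneratesFractions K z) (ω : Ω[F⁄K]) :
    ∃ a : F, ω = a • KaehlerDifferential.D K F z := by
  have hω : ω ∈ Submodule.span F (Set.range (KaehlerDifferential.D K F)) := by
    rw [KaehlerDifferential.span_range_derivation]; trivial
  induction hω using Submodule.span_induction with
  | mem ω h =>
    obtain ⟨g, rfl⟩ := h
    obtain ⟨a, b, hb, rfl⟩ := hz g
    exact ⟨_, exists_D_eq_smul hb (mul_div_cancel₀ _ hb)⟩
  | zero => exact ⟨0, by simp⟩
  | add x y _ _ hx hy =>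
    obtain ⟨a, rfl⟩ := hx
    obtain ⟨b, rfl⟩ := hy
    exact ⟨a + b, by rw [add_smul]⟩
  | smul c x _ hx =>
    obtain ⟨a, rfl⟩ := hx
    exact ⟨c * a, by rw [mul_smul]⟩

theorem GeneratesFractions.isLocalGenerator_cotangent {z : F} (hz : GeneratesFractions K z)
    (h0 : KaehlerDifferential.D K F z ≠ 0) {P : Point K F} (hP : z ∈ P.ring) :
    (CurveSheaf.cotangent K F).IsLocalGenerator P (KaehlerDifferential.D K F z) := by
  refine CurveSheaf.IsLocalGenerator.of_span rfl h0 hz.exists_eq_smul_D ⟨⟨z, hP⟩, rfl⟩ ?_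
  rintro _ ⟨g, rfl⟩
  obtain ⟨a, b, hb, hbP, h⟩ := hz.exists_fraction hP g.2
  exact ⟨_, mul_mem hbP (sub_mem (P.aeval_mem hP _) (mul_mem g.2 (P.aeval_mem hP _))),
    exists_D_eq_smul hb h⟩

end Differentials

/-! ### Points of the projective line -/

section Line

variable {K : Type u} [Field K]

theorem aeval_X_eq_algebraMap (a : K[X]) :
    Polynomial.aeval (RatFunc.X : RatFunc K) a = algebraMap K[X] (RatFunc K) a := by
  rw [← RatFunc.algebraMap_X, Polynomial.aeval_algebraMap_apply, Polynomial.aeval_X_left_apply]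

theorem generatesFractions_X : GeneratesFractions K (RatFunc.X : RatFunc K) := fun g =>
  ⟨g.num, g.denom, by
    rw [aeval_X_eq_algebraMap]
    exact RatFunc.algebraMap_ne_zero g.denom_ne_zero, by
    rw [aeval_X_eq_algebraMap, aeval_X_eq_algebraMap, RatFunc.num_div_denom]⟩

/-- Passage to the coordinate `1 / X`: the reversed polynomial has the leading coefficient as its
constant term, so for `a ≠ 0` its value is a unit at infinity. -/
theorem aeval_X_eq_pow_mul (a : K[X]) : Polynomial.aeval (RatFunc.X : RatFunc K) a =
    RatFunc.X ^ a.natDegree * Polynomial.aeval (RatFunc.X : RatFunc K)⁻¹ a.reverse := by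
  let : Invertible (RatFunc.X : RatFunc K) := invertibleOfNonzero RatFunc.X_ne_zero
  have := Polynomial.eval₂_reverse_mul_pow (algebraMap K (RatFunc K)) (RatFunc.X : RatFunc K) a
  rw [invOf_eq_inv] at this
  rw [Polynomial.aeval_def, Polynomial.aeval_def, ← this, mul_comm]

theorem generatesFractions_X_inv : GeneratesFractions K (RatFunc.X : RatFunc K)⁻¹ := fun g => by
  obtain ⟨a, b, hb, rfl⟩ := generatesFractions_X g
  rw [aeval_X_eq_pow_mul] at hb
  have hX : (RatFunc.X : RatFunc K) ≠ 0 := RatFunc.X_ne_zero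
  refine ⟨Polynomial.X ^ b.natDegree * a.reverse, Polynomial.X ^ a.natDegree * b.reverse, ?_, ?_⟩
  · simpa [hX] using right_ne_zero_of_mul hb
  · have := right_ne_zero_of_mul hb
    rw [aeval_X_eq_pow_mul a, aeval_X_eq_pow_mul b]
    simp only [map_mul, map_pow, Polynomial.aeval_X, inv_pow]
    field_simp

/-- `K(X)` is a localization of `K[X]`, hence formally étale over it, so its differentials are `K(X)
⊗ Ω[K[X]⁄K]`, free on `1 ⊗ dX`. -/
theorem D_X_ne_zero : KaehlerDifferential.D K (RatFunc K) RatFunc.X ≠ 0 := by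
  have hFE : Algebra.FormallyEtale K[X] (RatFunc K) :=
    Algebra.FormallyEtale.of_isLocalization (nonZeroDivisors K[X])
  intro h
  have h1 := KaehlerDifferential.tensorKaehlerEquivOfFormallyEtale_symm_D_algebraMap
    K K[X] (RatFunc K) Polynomial.X
  rw [RatFunc.algebraMap_X, h, map_zero] at h1
  have h2 := congrArg (LinearMap.lTensor (RatFunc K)
    (KaehlerDifferential.polynomialEquiv K).toLinearMap) h1
  simp at h2
  have h3 := congrArg (TensorProduct.rid K[X] (RatFunc K)) h2
  simp at h3

theorem D_X_inv : KaehlerDifferential.D K (RatFunc K) RatFunc.X⁻¹ =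
    (-(RatFunc.X : RatFunc K)⁻¹ ^ 2) • KaehlerDifferential.D K (RatFunc K) RatFunc.X := by
  have := (KaehlerDifferential.D K (RatFunc K)).leibniz_inv RatFunc.X
  simpa using this

variable {P : Point K (RatFunc K)}

theorem Point.inv_X_mem (hP : RatFunc.X ∉ P.ring) : (RatFunc.X : RatFunc K)⁻¹ ∈ P.ring :=
  (P.ring.mem_or_inv_mem _).resolve_left hP

theorem isLocalGenerator_cotangent_of_mem (hP : RatFunc.X ∈ P.ring) :
    (CurveSheaf.cotangent K (RatFunc K)).IsLocalGenerator P
      (KaehlerDifferential.D K (RatFunc K) RatFunc.X) :=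
  generatesFractions_X.isLocalGenerator_cotangent D_X_ne_zero hP

theorem D_X_inv_ne_zero : KaehlerDifferential.D K (RatFunc K) RatFunc.X⁻¹ ≠ 0 := by
  rw [D_X_inv]
  exact smul_ne_zero (by simp [RatFunc.X_ne_zero]) D_X_ne_zero

theorem isLocalGenerator_cotangent_of_notMem (hP : RatFunc.X ∉ P.ring) :
    (CurveSheaf.cotangent K (RatFunc K)).IsLocalGenerator P
      (KaehlerDifferential.D K (RatFunc K) RatFunc.X⁻¹) :=
  generatesFractions_X_inv.isLocalGenerator_cotangent D_X_inv_ne_zero (P.inv_X_mem hP)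

/-- The coordinate `1 / X` at infinity. -/
def Point.param (hP : RatFunc.X ∉ P.ring) : P.ring := ⟨RatFunc.X⁻¹, P.inv_X_mem hP⟩

theorem Point.param_mem_max (hP : RatFunc.X ∉ P.ring) : P.param hP ∈ P.max := by
  rw [IsLocalRing.mem_maximalIdeal, mem_nonunits_iff]
  intro hu
  obtain ⟨b, hb⟩ := hu.exists_right_inv
  have hb' : (RatFunc.X : RatFunc K)⁻¹ * (b : RatFunc K) = 1 := congrArg Subtype.val hb
  have : (b : RatFunc K) = RatFunc.X := by
    have h := eq_inv_of_mul_eq_one_right hb'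
    simpa using h
  exact hP (this ▸ b.2)

theorem Point.isUnit_aeval_param (hP : RatFunc.X ∉ P.ring) {q : K[X]} (hq : q.coeff 0 ≠ 0) :
    IsUnit (Polynomial.aeval (P.param hP) q) := by
  by_contra h
  have h1 : Polynomial.aeval (P.param hP) q ∈ P.max := h
  rw [← Polynomial.X_mul_divX_add q, map_add, map_mul, Polynomial.aeval_X,
    Polynomial.aeval_C] at h1
  have h2 := (Ideal.add_mem_iff_right _ (P.max.mul_mem_right _ (P.param_mem_max hP))).1 h1
  exact h2 ((IsUnit.mk0 _ hq).map (algebraMap K P.ring))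

/-- Numerator and denominator are each a power of `X` times a reversed polynomial in `1 / X` with
nonzero constant term. -/
theorem Point.exists_eq_zpow_mul (hP : RatFunc.X ∉ P.ring) {g : RatFunc K} (hg : g ≠ 0) :
    ∃ u : P.ringˣ, g = RatFunc.X ^ g.intDegree * ((u : P.ring) : RatFunc K) := by
  have key (a : K[X]) (ha : a ≠ 0) : ∃ u : P.ringˣ, algebraMap K[X] (RatFunc K) a =
      RatFunc.X ^ a.natDegree * ((u : P.ring) : RatFunc K) := by
    obtain ⟨u, hu⟩ := P.isUnit_aeval_param hP (q := a.reverse) (by simpa using ha)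
    refine ⟨u, ?_⟩
    rw [hu, P.coe_aeval, ← aeval_X_eq_algebraMap, aeval_X_eq_pow_mul]
    rfl
  obtain ⟨u, hu⟩ := key g.num (RatFunc.num_ne_zero hg)
  obtain ⟨v, hv⟩ := key g.denom g.denom_ne_zero
  have hvv : ((v : P.ring) : RatFunc K) * ((v⁻¹ : P.ringˣ) : P.ring) = 1 :=
    congrArg Subtype.val v.mul_inv
  have hv0 : ((v : P.ring) : RatFunc K) ≠ 0 := left_ne_zero_of_mul_eq_one hvv
  refine ⟨u * v⁻¹, ?_⟩
  conv_lhs => rw [← g.num_div_denom, hu, hv]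
  rw [RatFunc.intDegree, zpow_sub₀ RatFunc.X_ne_zero, zpow_natCast, zpow_natCast]
  have : (((u * v⁻¹ : P.ringˣ) : P.ring) : RatFunc K) =
    ((u : P.ring) : RatFunc K) * ((v : P.ring) : RatFunc K)⁻¹ := by
    rw [← eq_inv_of_mul_eq_one_right hvv]; rfl
  rw [this]
  field_simp

end Line

/-! ### Uniqueness of the point at infinity, and its uniformizer -/

section Infinity

variable {K : Type u} [Field K] {P Q : Point K (RatFunc K)}

theorem Point.notMem_max_of_inv_mem {F : Type u} [Field F] [Algebra K F] {P : Point K F}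
    {a : P.ring} (h0 : (a : F) ≠ 0) (ha : (a : F)⁻¹ ∈ P.ring) : a ∉ P.max := fun h =>
  h (IsUnit.of_mul_eq_one ⟨_, ha⟩ (Subtype.ext (mul_inv_cancel₀ h0)))

theorem Point.inv_mem_of_notMem_max {F : Type u} [Field F] [Algebra K F] {P : Point K F}
    {a : P.ring} (ha : a ∉ P.max) : (a : F)⁻¹ ∈ P.ring := by
  rw [IsLocalRing.mem_maximalIdeal, mem_nonunits_iff, not_not] at ha
  obtain ⟨b, hb⟩ := ha.exists_right_inv
  have hb' : (a : F) * (b : F) = 1 := congrArg Subtype.val hb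
  rw [← eq_inv_of_mul_eq_one_right hb']
  exact b.2

theorem Point.coe_unit_ne_zero {F : Type u} [Field F] [Algebra K F] {P : Point K F} (u : P.ringˣ) :
    ((u : P.ring) : F) ≠ 0 := fun h => u.ne_zero (Subtype.ext h)

/-- An element of positive degree in the ring would put some `X ^ (m + 1)` there, hence also `X = X
^ (m + 1) * (1 / X) ^ m`. The criterion determines the local ring, so only one point omits `X`. -/
theorem Point.mem_ring_iff_intDegree (hP : RatFunc.X ∉ P.ring) {g : RatFunc K} (hg : g ≠ 0) :
    g ∈ P.ring ↔ g.intDegree ≤ 0 := by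
  obtain ⟨u, hu⟩ := P.exists_eq_zpow_mul hP hg
  constructor
  · intro h
    by_contra! hd
    have h1 : (RatFunc.X : RatFunc K) ^ g.intDegree ∈ P.ring := by
      have : (RatFunc.X : RatFunc K) ^ g.intDegree = g * ((u⁻¹ : P.ringˣ) : P.ring) := by
        have huu : ((u : P.ring) : RatFunc K) * ((u⁻¹ : P.ringˣ) : P.ring) = 1 :=
          congrArg Subtype.val u.mul_inv
        rw [hu, mul_assoc]
        rw [← hu, huu, mul_one]
      rw [this]
      exact mul_mem h (Subtype.property _)
    obtain ⟨n, hn⟩ := Int.eq_ofNat_of_zero_le hd.le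
    rw [hn, zpow_natCast] at h1
    refine hP ?_
    obtain ⟨m, rfl⟩ : ∃ m, n = m + 1 := ⟨n - 1, by omega⟩
    have h2 := mul_mem h1 (pow_mem (P.inv_X_mem hP) m)
    have hX : (RatFunc.X : RatFunc K) ≠ 0 := RatFunc.X_ne_zero
    rwa [pow_succ', inv_pow, mul_inv_cancel_right₀ (pow_ne_zero m hX)] at h2
  · intro hd
    obtain ⟨n, hn⟩ := Int.eq_ofNat_of_zero_le (neg_nonneg.2 hd)
    rw [hu, show g.intDegree = -(n : ℤ) by omega, zpow_neg, zpow_natCast, ← inv_pow]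
    exact mul_mem (pow_mem (P.inv_X_mem hP) _) (Subtype.property _)

theorem Point.eq_of_X_notMem (hP : RatFunc.X ∉ P.ring) (hQ : RatFunc.X ∉ Q.ring) : P = Q := by
  have : P.ring = Q.ring := by
    ext g
    by_cases hg : g = 0
    · simp [hg]
    · rw [P.mem_ring_iff_intDegree hP hg, Q.mem_ring_iff_intDegree hQ hg]
  cases P; cases Q
  simpa using this

theorem X_notMem_infinity : RatFunc.X ∉ (infinity K).ring := by
  classical
  have h : RatFunc.X ∉ (RatFunc.inftyValuation K).valuationSubring := by
    rw [Valuation.mem_valuationSubring_iff, RatFunc.inftyValuation_apply,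
      RatFunc.inftyValuationDef, if_neg RatFunc.X_ne_zero, RatFunc.intDegree_X, not_le,
      ← WithZero.exp_zero, WithZero.exp_lt_exp]
    exact one_pos
  convert h using 2
  rfl

theorem Point.eq_infinity_iff : P = infinity K ↔ RatFunc.X ∉ P.ring :=
  ⟨fun h => h ▸ X_notMem_infinity, fun h => P.eq_of_X_notMem h X_notMem_infinity⟩

theorem Point.exists_eq_param_pow_mul (hP : RatFunc.X ∉ P.ring) {r : P.ring} (hr : r ≠ 0) :
    ∃ (n : ℕ) (u : P.ringˣ), r = P.param hP ^ n * u := by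
  have hr' : (r : RatFunc K) ≠ 0 := fun h => hr (Subtype.ext h)
  obtain ⟨u, hu⟩ := P.exists_eq_zpow_mul hP hr'
  obtain ⟨n, hn⟩ := Int.eq_ofNat_of_zero_le
    (neg_nonneg.2 ((P.mem_ring_iff_intDegree hP hr').1 r.2))
  refine ⟨n, u, Subtype.ext (hu.trans ?_)⟩
  rw [show (r : RatFunc K).intDegree = -(n : ℤ) by omega, zpow_neg, zpow_natCast, ← inv_pow]
  rfl

theorem Point.max_eq_span_param (hP : RatFunc.X ∉ P.ring) : P.max = Ideal.span {P.param hP} := by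
  refine le_antisymm (fun r hr => ?_) ((Ideal.span_singleton_le_iff_mem _).2 (P.param_mem_max hP))
  rw [Ideal.mem_span_singleton]
  by_cases h0 : r = 0
  · simp [h0]
  obtain ⟨n, u, rfl⟩ := P.exists_eq_param_pow_mul hP h0
  rcases n with - | n
  · simp at hr
  · exact (dvd_pow_self _ n.succ_ne_zero).mul_right _

end Infinity

/-! ### Points of the affine line, and the genus of the projective line -/

section FinitePoints

variable {K : Type u} [Field K]

/-- The prime ideal of `K[X]` corresponding to a point of the affine line. -/
def Point.affineIdeal (P : Point K (RatFunc K)) (hP : RatFunc.X ∈ P.ring) : Ideal K[X] :=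
  P.max.comap (Polynomial.aeval (⟨RatFunc.X, hP⟩ : P.ring) : K[X] →ₐ[K] P.ring)

instance (P : Point K (RatFunc K)) (hP : RatFunc.X ∈ P.ring) : (P.affineIdeal hP).IsPrime :=
  inferInstanceAs (Ideal.comap _ _).IsPrime

variable {P Q : Point K (RatFunc K)}

theorem Point.notMem_affineIdeal_iff (hP : RatFunc.X ∈ P.ring) {b : K[X]} (hb : b ≠ 0) :
    b ∉ P.affineIdeal hP ↔ (algebraMap K[X] (RatFunc K) b)⁻¹ ∈ P.ring := by
  have h0 : algebraMap K[X] (RatFunc K) b ≠ 0 := RatFunc.algebraMap_ne_zero hb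
  have e : ((Polynomial.aeval (⟨RatFunc.X, hP⟩ : P.ring) b : P.ring) : RatFunc K) =
      algebraMap K[X] (RatFunc K) b := by rw [P.coe_aeval, aeval_X_eq_algebraMap]
  constructor
  · intro h
    rw [← e]
    exact Point.inv_mem_of_notMem_max h
  · intro h
    rw [← e] at h h0
    exact Point.notMem_max_of_inv_mem h0 h

/-- The elements of the local ring are fractions with denominators outside the prime ideal, by
`GeneratesFractions.exists_fraction`. -/
theorem Point.ring_le_of_affineIdeal_eq (hP : RatFunc.X ∈ P.ring) (hQ : RatFunc.X ∈ Q.ring)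
    (h : P.affineIdeal hP = Q.affineIdeal hQ) : P.ring ≤ Q.ring := by
  intro g hg
  obtain ⟨a, b, hb, hbP, hab⟩ := generatesFractions_X.exists_fraction hP hg
  have hb0 : b ≠ 0 := by
    rintro rfl
    simp at hb
  have hbQ : (Polynomial.aeval (RatFunc.X : RatFunc K) b)⁻¹ ∈ Q.ring := by
    rw [aeval_X_eq_algebraMap] at hbP ⊢
    rwa [← Q.notMem_affineIdeal_iff hQ hb0, ← h, P.notMem_affineIdeal_iff hP hb0]
  rw [show g = (Polynomial.aeval (RatFunc.X : RatFunc K) b)⁻¹ * Polynomial.aeval RatFunc.X a by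
    rw [← hab, inv_mul_cancel_left₀ hb]]
  exact mul_mem hbQ (Q.aeval_mem hQ a)

theorem Point.eq_of_affineIdeal_eq (hP : RatFunc.X ∈ P.ring) (hQ : RatFunc.X ∈ Q.ring)
    (h : P.affineIdeal hP = Q.affineIdeal hQ) : P = Q := by
  have : P.ring = Q.ring := le_antisymm (P.ring_le_of_affineIdeal_eq hP hQ h)
    (Q.ring_le_of_affineIdeal_eq hQ hP h.symm)
  cases P; cases Q
  simpa using this

/-- A nonzero rational function is a unit in all but finitely many local rings. -/
theorem finite_setOf_not_unit {g : RatFunc K} (hg : g ≠ 0) :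
    {P : Point K (RatFunc K) | ¬ (RatFunc.X ∈ P.ring ∧ g ∈ P.ring ∧ g⁻¹ ∈ P.ring)}.Finite := by
  classical
  -- Away from infinity, `g` can fail to be a unit only at primes dividing `c`. The generic point is
  -- not among them: its prime is zero and `c ≠ 0`.
  let c : K[X] := g.num * g.denom
  have hc : c ≠ 0 := mul_ne_zero (RatFunc.num_ne_zero hg) g.denom_ne_zero
  have hfin := Ideal.finite_factors (I := Ideal.span {c}) (by simpa using hc)
  refine Set.Finite.subset (Set.Finite.union (Set.finite_singleton (infinity K))
    (Set.Finite.of_finite_image (s := {P : Point K (RatFunc K) | ∃ hP : RatFunc.X ∈ P.ring,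
      c ∈ P.affineIdeal hP}) (f := fun P => if hP : RatFunc.X ∈ P.ring then P.affineIdeal hP else ⊥)
      ((hfin.image fun v => v.asIdeal).subset ?_) ?_)) ?_
  · rintro _ ⟨P, ⟨hP, hcP⟩, rfl⟩
    simp only [hP, dif_pos]
    refine ⟨⟨P.affineIdeal hP, inferInstance, fun h => hc ?_⟩, ?_, rfl⟩
    · simpa [h] using hcP
    · simpa [Ideal.dvd_span_singleton] using hcP
  · rintro P ⟨hP, -⟩ Q ⟨hQ, -⟩ h
    simp only [hP, hQ, dif_pos] at h
    exact P.eq_of_affineIdeal_eq hP hQ h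
  · intro P hbad
    by_cases hP : RatFunc.X ∈ P.ring
    · refine Or.inr ⟨hP, ?_⟩
      by_contra hcP
      refine hbad ⟨hP, ?_⟩
      have h1 : g.num ∉ P.affineIdeal hP := fun h => hcP (Ideal.mul_mem_right _ _ h)
      have h2 : g.denom ∉ P.affineIdeal hP := fun h => hcP (Ideal.mul_mem_left _ _ h)
      rw [P.notMem_affineIdeal_iff hP (RatFunc.num_ne_zero hg)] at h1
      rw [P.notMem_affineIdeal_iff hP g.denom_ne_zero] at h2
      have hmem (a : K[X]) : algebraMap K[X] (RatFunc K) a ∈ P.ring := by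
        rw [← aeval_X_eq_algebraMap]; exact P.aeval_mem hP a
      rw [← g.num_div_denom, inv_div, div_eq_mul_inv, div_eq_mul_inv]
      exact ⟨mul_mem (hmem _) h2, mul_mem (hmem _) h1⟩
    · exact Or.inl (Point.eq_infinity_iff.2 hP)

/-- The point of the affine line with a given maximal ideal. -/
def Point.ofHeightOne (v : IsDedekindDomain.HeightOneSpectrum K[X]) : Point K (RatFunc K) where
  ring := (v.valuation (RatFunc K)).valuationSubring
  algebraMap_mem c := by
    rw [Valuation.mem_valuationSubring_iff, IsScalarTower.algebraMap_apply K K[X] (RatFunc K)]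
    exact v.valuation_le_one _

/-- Regularity on the affine line makes the coefficient of `dX` a polynomial `q`. At infinity `q dX
= -q X² d(1 / X)`, and `q X²` has positive degree unless `q = 0`. -/
theorem globalDifferentials_eq_bot : globalDifferentials K (RatFunc K) = ⊥ := by
  rw [eq_bot_iff]
  intro ω hω
  obtain ⟨g, rfl⟩ := generatesFractions_X.exists_eq_smul_D ω
  have hint : ∃ q : K[X], algebraMap K[X] (RatFunc K) q = g := by
    refine IsDedekindDomain.HeightOneSpectrum.mem_integers_of_valuation_le_one _ g fun v => ?_
    have hX : RatFunc.X ∈ (Point.ofHeightOne v).ring := by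
      change _ ∈ (v.valuation (RatFunc K)).valuationSubring
      rw [Valuation.mem_valuationSubring_iff, ← RatFunc.algebraMap_X]
      exact v.valuation_le_one _
    exact ((isLocalGenerator_cotangent_of_mem hX).smul_mem_iff g).1 (hω _)
  obtain ⟨q, rfl⟩ := hint
  by_cases hq : q = 0
  · simp [hq]
  have hq' : algebraMap K[X] (RatFunc K) q ≠ 0 := RatFunc.algebraMap_ne_zero hq
  have hX : (RatFunc.X : RatFunc K) ≠ 0 := RatFunc.X_ne_zero
  have h := hω (infinity K)
  have e : algebraMap K[X] (RatFunc K) q • KaehlerDifferential.D K (RatFunc K) RatFunc.X =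
      (-(algebraMap K[X] (RatFunc K) q * RatFunc.X * RatFunc.X)) •
        KaehlerDifferential.D K (RatFunc K) RatFunc.X⁻¹ := by
    rw [D_X_inv, smul_smul]
    congr 1
    field_simp
  rw [e] at h
  have h1 := ((isLocalGenerator_cotangent_of_notMem X_notMem_infinity).smul_mem_iff _).1 h
  rw [Point.mem_ring_iff_intDegree X_notMem_infinity
    (neg_ne_zero.2 (mul_ne_zero (mul_ne_zero hq' hX) hX)), RatFunc.intDegree_neg,
    RatFunc.intDegree_mul (mul_ne_zero hq' hX) hX, RatFunc.intDegree_mul hq' hX,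
    RatFunc.intDegree_X, RatFunc.intDegree_polynomial] at h1
  omega

theorem genus_ratFunc : genus K (RatFunc K) = 0 := by
  rw [genus, globalDifferentials_eq_bot, finrank_bot]

theorem eulerChar_ratFunc : eulerChar K (RatFunc K) = GW.hyp K := by
  rw [eulerChar, genus_ratFunc]
  simp

end FinitePoints

/-! ### The residue field at infinity -/

section Residue

variable {K : Type u} [Field K] {P : Point K (RatFunc K)}

theorem Point.algebraMap_mem_max_iff {F : Type u} [Field F] [Algebra K F] {P : Point K F} {c : K} :
    algebraMap K P.ring c ∈ P.max ↔ c = 0 := by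
  refine ⟨fun h => ?_, fun h => by simp [h]⟩
  by_contra hc
  exact h ((IsUnit.mk0 c hc).map (algebraMap K P.ring))

theorem Point.aeval_sub_mem_max {F : Type u} [Field F] [Algebra K F] {P : Point K F}
    {z : P.ring} {a : K} (hz : z - algebraMap K P.ring a ∈ P.max) (q : K[X]) :
    Polynomial.aeval z q - algebraMap K P.ring (q.eval a) ∈ P.max := by
  have h := map_dvd (Polynomial.aeval z) (Polynomial.X_sub_C_dvd_sub_C_eval (a := a) (p := q))
  simp only [map_sub, Polynomial.aeval_X, Polynomial.aeval_C] at h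
  exact Ideal.mem_of_dvd _ h hz

/-- The residue field at infinity is `K`. -/
theorem Point.exists_sub_algebraMap_mem_max (hP : RatFunc.X ∉ P.ring) (r : P.ring) :
    ∃ a : K, r - algebraMap K P.ring a ∈ P.max := by
  obtain ⟨A, B, hB0, hB, hAB⟩ := generatesFractions_X_inv.exists_fraction (P.inv_X_mem hP) r.2
  have hw : P.param hP - algebraMap K P.ring 0 ∈ P.max := by
    simpa using P.param_mem_max hP
  have hB' : Polynomial.aeval (P.param hP) B ∉ P.max := by
    refine Point.notMem_max_of_inv_mem ?_ ?_ <;> rw [P.coe_aeval]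
    exacts [hB0, hB]
  have hA1 := Point.aeval_sub_mem_max hw A
  have hB1 := Point.aeval_sub_mem_max hw B
  have hBe : B.eval 0 ≠ 0 := by
    intro h
    rw [h, map_zero, sub_zero] at hB1
    exact hB' hB1
  have hAB' : Polynomial.aeval (P.param hP) B * r = Polynomial.aeval (P.param hP) A := by
    refine Subtype.ext ?_
    change ((Polynomial.aeval (P.param hP) B : P.ring) : RatFunc K) * r = _
    rw [P.coe_aeval, P.coe_aeval]
    exact hAB
  -- The residue of `A(w) / B(w)` at `w = 0`; it suffices to check this after multiplying by `B(w)`,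
  -- which is outside the prime ideal.
  refine ⟨A.eval 0 / B.eval 0, (Ideal.IsPrime.mem_or_mem inferInstance ?_).resolve_left hB'⟩
  have e : algebraMap K P.ring (A.eval 0) =
      algebraMap K P.ring (B.eval 0) * algebraMap K P.ring (A.eval 0 / B.eval 0) := by
    rw [← map_mul, mul_div_cancel₀ _ hBe]
  have : Polynomial.aeval (P.param hP) B * (r - algebraMap K P.ring (A.eval 0 / B.eval 0)) =
      (Polynomial.aeval (P.param hP) A - algebraMap K P.ring (A.eval 0)) -
        algebraMap K P.ring (A.eval 0 / B.eval 0) *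
          (Polynomial.aeval (P.param hP) B - algebraMap K P.ring (B.eval 0)) := by
    rw [mul_sub, hAB', e]
    ring
  rw [this]
  exact sub_mem hA1 (Ideal.mul_mem_left _ _ hB1)

end Residue

/-! ### Nisnevich coordinates at infinity and the algebra `Q` -/

namespace NisnevichCoordinate

variable {K : Type u} [Field K]

section General

variable {F : Type u} [Field F] [Algebra K F] {P : Point K F} (c : NisnevichCoordinate P) {a : K}

/-- The parameter `X - a` of the local ring of the affine line at a rational point. -/
def shift (a : K) : c.LocalRing := algebraMap K[X] c.LocalRing (Polynomial.X - Polynomial.C a)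

theorem pull_algebraMap (q : K[X]) :
    c.pull (algebraMap K[X] c.LocalRing q) = Polynomial.aeval c.φ q :=
  IsLocalization.lift_eq _ q

theorem pull_shift : c.pull (c.shift a) = c.φ - algebraMap K P.ring a := by
  rw [shift, pull_algebraMap, map_sub, Polynomial.aeval_X, Polynomial.aeval_C]

theorem mem_image_iff (ha : c.φ - algebraMap K P.ring a ∈ P.max) {q : K[X]} :
    q ∈ c.image ↔ q.eval a = 0 := by
  have h := Point.aeval_sub_mem_max ha q
  rw [← Point.algebraMap_mem_max_iff (P := P)]
  change Polynomial.aeval c.φ q ∈ P.max ↔ _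
  constructor
  · exact fun h' => by simpa using sub_mem h' h
  · exact fun h' => by simpa using add_mem h h'

theorem isUnit_algebraMap (ha : c.φ - algebraMap K P.ring a ∈ P.max) {q : K[X]}
    (hq : q.eval a ≠ 0) : IsUnit (algebraMap K[X] c.LocalRing q) :=
  IsLocalization.map_units c.LocalRing
    (⟨q, fun h => hq ((c.mem_image_iff ha).1 h)⟩ : c.image.primeCompl)

theorem exists_eq_mul_algebraMap (ha : c.φ - algebraMap K P.ring a ∈ P.max) (r : c.LocalRing) :
    ∃ g h : K[X], h.eval a ≠ 0 ∧
      r * algebraMap K[X] c.LocalRing h = algebraMap K[X] c.LocalRing g := by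
  obtain ⟨⟨g, h⟩, hgh⟩ := IsLocalization.surj c.image.primeCompl r
  exact ⟨g, h, fun h0 => h.2 ((c.mem_image_iff ha).2 h0), hgh⟩

theorem exists_eq_algebraMap_add (ha : c.φ - algebraMap K P.ring a ∈ P.max) (r : c.LocalRing) :
    ∃ (b : K) (s : c.LocalRing), r = algebraMap K c.LocalRing b + c.shift a * s := by
  obtain ⟨g, h, hh, hr⟩ := c.exists_eq_mul_algebraMap ha r
  obtain ⟨u, hu⟩ := c.isUnit_algebraMap ha hh
  obtain ⟨q, hq⟩ : Polynomial.X - Polynomial.C a ∣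
      g - Polynomial.C (g.eval a / h.eval a) * h := by
    rw [Polynomial.dvd_iff_isRoot]
    simp [hh]
  refine ⟨g.eval a / h.eval a, algebraMap K[X] c.LocalRing q * ↑u⁻¹, ?_⟩
  have h1 := congrArg (algebraMap K[X] c.LocalRing) hq
  have e (b : K) : algebraMap K[X] c.LocalRing (Polynomial.C b) = algebraMap K c.LocalRing b :=
    (IsScalarTower.algebraMap_apply K K[X] c.LocalRing b).symm
  rw [map_sub, map_mul, map_mul, ← hr, ← hu, e, ← sub_mul] at h1
  rw [← mul_assoc, shift, ← h1, mul_assoc, Units.mul_inv, mul_one, add_sub_cancel]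

/-- Split the full power of `X - a` off the numerator; what remains does not vanish at `a` and is a
unit. -/
theorem exists_eq_shift_pow_mul (ha : c.φ - algebraMap K P.ring a ∈ P.max) {r : c.LocalRing}
    (hr0 : r ≠ 0) : ∃ (n : ℕ) (u : c.LocalRingˣ), r = c.shift a ^ n * u := by
  obtain ⟨g, h, hh, hr⟩ := c.exists_eq_mul_algebraMap ha r
  obtain ⟨u, hu⟩ := c.isUnit_algebraMap ha hh
  have hg0 : g ≠ 0 := by
    rintro rfl
    rw [map_zero, ← hu] at hr
    exact hr0 (by simpa using hr)
  obtain ⟨q, hq, hndvd⟩ := Polynomial.exists_eq_pow_rootMultiplicity_mul_and_not_dvd g hg0 a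
  obtain ⟨v, hv⟩ := c.isUnit_algebraMap ha (q := q) (by rwa [Polynomial.dvd_iff_isRoot] at hndvd)
  refine ⟨g.rootMultiplicity a, v * u⁻¹, ?_⟩
  have h1 := congrArg (algebraMap K[X] c.LocalRing) hq
  rw [← hr, map_mul, map_pow, ← hv, ← hu] at h1
  rw [Units.val_mul, ← mul_assoc, shift, ← h1, mul_assoc, Units.mul_inv, mul_one]

/-- The relation defining `a` in the index data involves `X`, while the nilpotent generator of `Q`
is `X - a`; the two differ by a scalar. -/
theorem adjoin_mk_X_eq_top {I : Ideal c.LocalRing}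
    (h : Algebra.adjoin K {Ideal.Quotient.mk I (c.shift a)} = ⊤) :
    Algebra.adjoin K {Ideal.Quotient.mk I c.X} = ⊤ := by
  rw [eq_top_iff, ← h]
  refine Algebra.adjoin_le (Set.singleton_subset_iff.2 ?_)
  have e : Ideal.Quotient.mk I (c.shift a) =
      Ideal.Quotient.mk I c.X - algebraMap K (c.LocalRing ⧸ I) a := by
    rw [shift, map_sub, map_sub, ← Polynomial.algebraMap_eq,
      ← IsScalarTower.algebraMap_apply K K[X] c.LocalRing]
    rfl
  rw [SetLike.mem_coe, e]
  exact sub_mem (Algebra.self_mem_adjoin_singleton K _) (Subalgebra.algebraMap_mem _ a)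

end General

variable {P : Point K (RatFunc K)} (c : NisnevichCoordinate P) {a : K}

/-- This is where étaleness enters. If `φ - a = w² s` and `ds = b dw`, then `dφ = w (w b + 2 s) dw`
would not generate the cotangent stalk; so `φ - a` is a uniformizer. -/
theorem exists_sub_eq_param_mul (hP : RatFunc.X ∉ P.ring)
    (ha : c.φ - algebraMap K P.ring a ∈ P.max) :
    ∃ u : P.ringˣ, c.φ - algebraMap K P.ring a = P.param hP * u := by
  have hgen := isLocalGenerator_cotangent_of_notMem hP
  have hmem (r : P.ring) : ∃ b : P.ring, KaehlerDifferential.D K (RatFunc K) (r : RatFunc K) =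
      (b : RatFunc K) • KaehlerDifferential.D K (RatFunc K) RatFunc.X⁻¹ :=
    hgen.exists_smul_of_mem_span rfl ⟨r, rfl⟩
  obtain ⟨r, hr⟩ := Ideal.mem_span_singleton.1 (P.max_eq_span_param hP ▸ ha)
  suffices hu : r ∉ P.max by
    rw [IsLocalRing.mem_maximalIdeal, mem_nonunits_iff, not_not] at hu
    exact ⟨hu.unit, hr⟩
  intro hrm
  obtain ⟨s, rfl⟩ := Ideal.mem_span_singleton.1 (P.max_eq_span_param hP ▸ hrm)
  obtain ⟨b, hb⟩ := hmem s
  have hφ : (c.φ : RatFunc K) = algebraMap K (RatFunc K) a +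
      RatFunc.X⁻¹ * (RatFunc.X⁻¹ * (s : RatFunc K)) := by
    have := congrArg (Subtype.val : P.ring → RatFunc K) hr
    exact sub_eq_iff_eq_add'.1 this
  let w := P.param hP
  have hD : KaehlerDifferential.D K (RatFunc K) (c.φ : RatFunc K) =
      ((w * (w * b + 2 * s) : P.ring) : RatFunc K) •
        KaehlerDifferential.D K (RatFunc K) RatFunc.X⁻¹ := by
    have hw : ((w * (w * b + 2 * s) : P.ring) : RatFunc K) =
      RatFunc.X⁻¹ * (RatFunc.X⁻¹ * (b : RatFunc K) + 2 * (s : RatFunc K)) := rfl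
    rw [hφ, map_add, Derivation.map_algebraMap, zero_add, Derivation.leibniz, Derivation.leibniz,
      hb, hw]
    simp only [smul_smul, ← add_smul]
    congr 1
    ring
  have hgen' := hgen.of_stalk_eq c.etale
  rw [hD] at hgen'
  obtain ⟨u, hu⟩ := hgen.exists_unit_smul hgen'
  have hwu : w * (w * b + 2 * s) = u := Subtype.ext (smul_left_injective _ hgen.ne_zero hu)
  exact (P.max.mul_mem_right (w * b + 2 * s) (P.param_mem_max hP)) (hwu ▸ u.isUnit)

/-- The local ring of a zero of order `n` in a Nisnevich coordinate. -/
theorem isTruncatedBy (hP : RatFunc.X ∉ P.ring) (ha : c.φ - algebraMap K P.ring a ∈ P.max)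
    {n : ℕ} (hn : 0 < n) {G : c.LocalRing} {u : P.ringˣ} (hG : c.pull G = P.param hP ^ n * u) :
    IsTruncatedBy K (Ideal.Quotient.mk (Ideal.span {G}) (c.shift a)) n := by
  obtain ⟨v, hv⟩ := c.exists_sub_eq_param_mul hP ha
  have hw0 : P.param hP ≠ 0 := fun h => inv_ne_zero (RatFunc.X_ne_zero (K := K))
    (congrArg Subtype.val h)
  have hpow (k l : ℕ) (r : P.ring) (s : P.ringˣ)
      (h : P.param hP ^ k * s = P.param hP ^ l * r) : l ≤ k := by
    by_contra! hlt
    obtain ⟨d, rfl⟩ := Nat.exists_eq_add_of_lt hlt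
    rw [show k + d + 1 = k + (d + 1) by ring, pow_add, mul_assoc] at h
    have h1 := mul_left_cancel₀ (pow_ne_zero k hw0) h
    refine (Ideal.mul_mem_right r P.max (Ideal.pow_mem_of_mem _ (P.param_mem_max hP) (d + 1)
      d.succ_pos)) (h1 ▸ s.isUnit)
  have hG0 : G ≠ 0 := by
    rintro rfl
    rw [map_zero] at hG
    exact mul_ne_zero (pow_ne_zero n hw0) u.ne_zero hG.symm
  -- Since `X - a` pulls back to a uniformizer, the order of `G` at `a` equals that of its pullback
  -- at `P`.
  obtain ⟨m, g, hg⟩ := c.exists_eq_shift_pow_mul ha hG0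
  have hGm : P.param hP ^ n * u = P.param hP ^ m *
      (v ^ m * Units.map c.pull.toMonoidHom g : P.ringˣ) := by
    rw [← hG, hg, map_mul, map_pow, c.pull_shift, hv, mul_pow]
    push_cast
    rw [mul_assoc]
    rfl
  obtain rfl : n = m := le_antisymm (hpow _ _ _ _ hGm.symm) (hpow _ _ _ _ hGm)
  refine ⟨hn, ?_, ?_, fun q => ?_⟩
  · rw [← map_pow, Ideal.Quotient.eq_zero_iff_mem, Ideal.mem_span_singleton]
    exact ⟨(g⁻¹ : c.LocalRingˣ), by rw [hg, mul_assoc, Units.mul_inv, mul_one]⟩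
  · rw [← map_pow, Ne, Ideal.Quotient.eq_zero_iff_mem, Ideal.mem_span_singleton]
    rintro ⟨r, hr⟩
    have h1 := congrArg c.pull hr
    rw [map_mul, map_pow, c.pull_shift, hG, hv, mul_pow, mul_assoc, ← Units.val_pow_eq_pow_val] at h1
    have := hpow _ _ _ _ h1
    omega
  · obtain ⟨r, rfl⟩ := Ideal.Quotient.mk_surjective q
    obtain ⟨b, s, rfl⟩ := c.exists_eq_algebraMap_add ha r
    exact ⟨b, Ideal.Quotient.mk _ s, by rw [map_add, map_mul]; rfl⟩

end NisnevichCoordinate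

/-- The local index at infinity of a section with a zero of even order is hyperbolic, for all
choices made in its computation. -/
theorem IndexData.formClass_eq {K : Type u} [Field K] (h2 : (2 : K) ≠ 0)
    {P : Point K (RatFunc K)} (hP : RatFunc.X ∉ P.ring) {L : CurveSheaf K (RatFunc K)}
    {o : L.RelativeOrientation} {σ : L.gen} {e₀ : L.gen} (he₀ : L.IsLocalGenerator P e₀)
    {m : ℕ} (hm : 0 < m) (hσ : σ = ((P.param hP ^ (2 * m) : P.ring) : RatFunc K) • e₀) {N : ℕ}
    (hN : 2 * m < N) (D : IndexData o σ P N) : D.formClass = m • GW.hyp K := by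
  obtain ⟨u, hu⟩ := he₀.exists_unit_smul (he₀.of_stalk_eq D.stalk_eq)
  have hf : P.param hP ^ (2 * m) = D.f * u := by
    refine Subtype.ext (smul_left_injective _ he₀.ne_zero ?_)
    change ((P.param hP ^ (2 * m) : P.ring) : RatFunc K) • e₀ =
      ((D.f : RatFunc K) * ((u : P.ring) : RatFunc K)) • e₀
    rw [mul_smul, ← hu, ← hσ]
    exact D.section_eq
  have hf' : D.f = P.param hP ^ (2 * m) * (u⁻¹ : P.ringˣ) := by
    rw [hf, mul_assoc, Units.mul_inv, mul_one]
  have happ := D.approx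
  rw [P.max_eq_span_param hP, Ideal.span_singleton_pow, Ideal.mem_span_singleton] at happ
  obtain ⟨r, hr⟩ := happ
  obtain ⟨d, rfl⟩ := Nat.exists_eq_add_of_lt hN
  -- Here `d + 1 = N - 2 * m > 0`, so the approximation error perturbs the unit factor of `D.f` by
  -- an element of the maximal ideal and `D.G` keeps the order `2 * m`.
  have hunit : IsUnit (((u⁻¹ : P.ringˣ) : P.ring) + P.param hP ^ (d + 1) * r) := by
    by_contra h
    have h1 : _ ∈ P.max := h
    rw [Ideal.add_mem_iff_left _ (Ideal.mul_mem_right r P.max (Ideal.pow_mem_of_mem _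
      (P.param_mem_max hP) (d + 1) d.succ_pos))] at h1
    exact h1 (u⁻¹).isUnit
  have hG : D.coord.pull D.G = P.param hP ^ (2 * m) * hunit.unit := by
    rw [sub_eq_iff_eq_add'.1 hr, hf', IsUnit.unit_spec]
    ring
  obtain ⟨a, ha⟩ := P.exists_sub_algebraMap_mem_max hP D.coord.φ
  have htr := D.coord.isTruncatedBy hP ha (by omega) hG
  refine ofForm_eq_of_isTruncatedBy h2 htr (D.coord.adjoin_mk_X_eq_top htr.adjoin_eq_top) ?_ D.η_eq
  -- In `Q ⊗ Q` the left side of `D.a_eq` becomes zero, so the image of `D.a` is annihilated by `x ⊗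
  -- 1 - 1 ⊗ x`.
  have h1 := congrArg (Algebra.TensorProduct.map (Ideal.Quotient.mkₐ K (Ideal.span {D.G}))
    (Ideal.Quotient.mkₐ K (Ideal.span {D.G}))) D.a_eq
  have h0 : Ideal.Quotient.mk (Ideal.span {D.G}) D.G = 0 :=
    Ideal.Quotient.eq_zero_iff_mem.2 (Ideal.mem_span_singleton_self _)
  simp only [map_sub, map_mul, Algebra.TensorProduct.map_tmul, Ideal.Quotient.mkₐ_eq_mk, h0,
    TensorProduct.zero_tmul, TensorProduct.tmul_zero, map_one, sub_zero] at h1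
  rw [← sub_eq_zero, ← sub_mul]
  exact (mul_comm _ _).trans h1.symm

section OneDimensional

variable {F V W : Type*} [Field F] [AddCommGroup V] [Module F V] [AddCommGroup W] [Module F W]

theorem exists_linearEquiv_apply_eq {v : V} (hv0 : v ≠ 0) (hv : ∀ x : V, ∃ a : F, x = a • v)
    {w : W} (hw0 : w ≠ 0) (hw : ∀ x : W, ∃ a : F, x = a • w) : ∃ φ : V ≃ₗ[F] W, φ v = w := by
  obtain ⟨φ, hφ⟩ := exists_linearMap_apply_eq (F := F) hv0 w
  obtain ⟨ψ, hψ⟩ := exists_linearMap_apply_eq (F := F) hw0 v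
  refine ⟨LinearEquiv.ofLinearMap φ ψ (LinearMap.ext fun x => ?_) (LinearMap.ext fun x => ?_), hφ⟩
  · obtain ⟨a, rfl⟩ := hw x
    simp [hφ, hψ]
  · obtain ⟨a, rfl⟩ := hv x
    simp [hφ, hψ]

end OneDimensional

/-! ### The relative orientation, and existence of the local index -/

section Orientation

variable {K : Type u} [Field K]

open Classical in
/-- The line bundle of degree `n` on the projective line: `1` is a generator at the points of the
affine line, and `X ^ n` at infinity. -/
def twist (K : Type u) [Field K] (n : ℕ) : CurveSheaf K (RatFunc K) where
  gen := RatFunc K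
  stalk P := if RatFunc.X ∈ P.ring then Submodule.span P.ring {1}
    else Submodule.span P.ring {RatFunc.X ^ n}

variable {P : Point K (RatFunc K)}

theorem twist_isLocalGenerator_of_mem (n : ℕ) (hP : RatFunc.X ∈ P.ring) :
    (twist K n).IsLocalGenerator P (1 : RatFunc K) :=
  ⟨one_ne_zero (α := RatFunc K), fun x : RatFunc K => ⟨x, (mul_one x).symm⟩, if_pos hP⟩

theorem twist_isLocalGenerator_of_notMem (n : ℕ) (hP : RatFunc.X ∉ P.ring) :
    (twist K n).IsLocalGenerator P (RatFunc.X ^ n : RatFunc K) :=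
  ⟨pow_ne_zero n (RatFunc.X_ne_zero (K := K)), fun x : RatFunc K => ⟨x * (RatFunc.X ^ n)⁻¹,
    (inv_mul_cancel_right₀ (pow_ne_zero n RatFunc.X_ne_zero) x).symm⟩, if_neg hP⟩

theorem twist_isLineBundle (n : ℕ) : (twist K n).IsLineBundle where
  rank_one := Module.finrank_self (RatFunc K)
  locally_free P := by
    by_cases hP : RatFunc.X ∈ P.ring
    · exact ⟨_, (twist_isLocalGenerator_of_mem n hP).ne_zero,
        (twist_isLocalGenerator_of_mem n hP).stalk_eq⟩
    · exact ⟨_, (twist_isLocalGenerator_of_notMem n hP).ne_zero,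
        (twist_isLocalGenerator_of_notMem n hP).stalk_eq⟩
  coherent e he := by
    change RatFunc K at e
    refine (finite_setOf_not_unit (g := e) he).subset fun P hP hu => hP ?_
    have h := (twist_isLocalGenerator_of_mem n hu.1).unit_smul hu.2.1 hu.2.2 he
    exact h.stalk_eq.trans (congrArg (fun x : RatFunc K => Submodule.span P.ring {x}) (mul_one e))

/-- A generator of the tangent sheaf on the affine line. -/
theorem exists_tangent : ∃ d : (CurveSheaf.tangent K (RatFunc K)).gen,
    (show Ω[RatFunc K⁄K] →ₗ[RatFunc K] RatFunc K from d)
      (KaehlerDifferential.D K (RatFunc K) RatFunc.X) = 1 :=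
  exists_linearMap_apply_eq D_X_ne_zero (1 : RatFunc K)

theorem tangent_apply_D_X_inv {d : (CurveSheaf.tangent K (RatFunc K)).gen}
    (hd : (show Ω[RatFunc K⁄K] →ₗ[RatFunc K] RatFunc K from d)
      (KaehlerDifferential.D K (RatFunc K) RatFunc.X) = 1) :
    (show Ω[RatFunc K⁄K] →ₗ[RatFunc K] RatFunc K from (-(RatFunc.X : RatFunc K) ^ 2) • d)
      (KaehlerDifferential.D K (RatFunc K) RatFunc.X⁻¹) = 1 := by
  rw [D_X_inv]
  let d' : Ω[RatFunc K⁄K] →ₗ[RatFunc K] RatFunc K := d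
  have hd' : d' (KaehlerDifferential.D K (RatFunc K) RatFunc.X) = 1 := hd
  change (-(RatFunc.X : RatFunc K) ^ 2) • d' _ = 1
  have hX : (RatFunc.X : RatFunc K) ≠ 0 := RatFunc.X_ne_zero
  rw [map_smul, hd', smul_eq_mul, smul_eq_mul]
  field_simp

/-- A line bundle of even positive degree `2 * (n + 1)` on the projective line, with a generator
`v` on the affine line, has a relative orientation for which `∂w ↦ X ^ (2 * (n + 1)) • v` is
a square at infinity, where `w = 1 / X`. -/
theorem exists_relativeOrientation {L : CurveSheaf K (RatFunc K)} {v : L.gen} {n : ℕ}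
    (hfin : ∀ P : Point K (RatFunc K), RatFunc.X ∈ P.ring → L.IsLocalGenerator P v)
    (hinf : ∀ P : Point K (RatFunc K), RatFunc.X ∉ P.ring →
      L.IsLocalGenerator P ((RatFunc.X ^ (2 * (n + 1)) : RatFunc K) • v)) :
    ∃ (o : L.RelativeOrientation) (s : o.M.gen) (d : (CurveSheaf.tangent K (RatFunc K)).gen),
      (show Ω[RatFunc K⁄K] →ₗ[RatFunc K] RatFunc K from d)
        (KaehlerDifferential.D K (RatFunc K) RatFunc.X⁻¹) = 1 ∧
      (∀ P : Point K (RatFunc K), RatFunc.X ∉ P.ring → o.M.stalk P = Submodule.span P.ring {s}) ∧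
      (show (CurveSheaf.tangent K (RatFunc K)).gen →ₗ[RatFunc K] L.gen from
        o.iso (s ⊗ₜ[RatFunc K] s)) d = (RatFunc.X ^ (2 * (n + 1)) : RatFunc K) • v := by
  have hX : (RatFunc.X : RatFunc K) ≠ 0 := RatFunc.X_ne_zero
  obtain ⟨d, hd⟩ := exists_tangent (K := K)
  have hd' := tangent_apply_D_X_inv hd
  have hT (P : Point K (RatFunc K)) (hP : RatFunc.X ∈ P.ring) :
      (CurveSheaf.tangent K (RatFunc K)).IsLocalGenerator P d :=
    (isLocalGenerator_cotangent_of_mem hP).hom (.structureSheaf P) hd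
  have hT' (P : Point K (RatFunc K)) (hP : RatFunc.X ∉ P.ring) :
      (CurveSheaf.tangent K (RatFunc K)).IsLocalGenerator P
        ((-(RatFunc.X : RatFunc K) ^ 2) • d) :=
    (isLocalGenerator_cotangent_of_notMem hP).hom (.structureSheaf P) hd'
  have hd0 : d ≠ 0 := by
    rintro rfl
    exact (hT' _ X_notMem_infinity).ne_zero (smul_zero _)
  -- The sign cancels the one in `∂w = -X² ∂X`, so that `X ^ (2 * n) • ε` sends `∂w` exactly to `X ^
  -- (2 * (n + 1)) • v`.
  obtain ⟨ε, hε⟩ := exists_linearMap_apply_eq (F := RatFunc K) hd0 (-v)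
  have hε' : ((RatFunc.X ^ (2 * n) : RatFunc K) • ε) ((-(RatFunc.X : RatFunc K) ^ 2) • d) =
      (RatFunc.X ^ (2 * (n + 1)) : RatFunc K) • v := by
    rw [LinearMap.smul_apply, map_smul, hε, smul_smul, smul_neg, ← neg_smul]
    congr 1
    ring
  have hH (P : Point K (RatFunc K)) (hP : RatFunc.X ∈ P.ring) :
      ((CurveSheaf.tangent K (RatFunc K)).hom L).IsLocalGenerator P ε := by
    refine (hT P hP).hom (e' := -v) ?_ hε
    have := (hfin P hP).unit_smul (c := -1) (neg_mem (one_mem _))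
      (by rw [inv_neg, inv_one]; exact neg_mem (one_mem _)) (by simp)
    rwa [neg_smul, one_smul] at this
  have hH' (P : Point K (RatFunc K)) (hP : RatFunc.X ∉ P.ring) :
      ((CurveSheaf.tangent K (RatFunc K)).hom L).IsLocalGenerator P
        ((RatFunc.X ^ (2 * n) : RatFunc K) • ε) :=
    (hT' P hP).hom (hinf P hP) hε'
  have hM (P : Point K (RatFunc K)) (hP : RatFunc.X ∈ P.ring) :=
    (twist_isLocalGenerator_of_mem n hP).tensor (twist_isLocalGenerator_of_mem n hP)
  have hM' (P : Point K (RatFunc K)) (hP : RatFunc.X ∉ P.ring) :=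
    (twist_isLocalGenerator_of_notMem n hP).tensor (twist_isLocalGenerator_of_notMem n hP)
  -- The isomorphism is prescribed on the generators at infinity, `X ^ n ⊗ X ^ n ↦ X ^ (2 * n) • ε`.
  -- Dividing by `X ^ (2 * n)` shows that it also matches the generators `1 ⊗ 1` and `ε` on the
  -- affine line.
  obtain ⟨φ, hφ⟩ := exists_linearEquiv_apply_eq (hM' _ X_notMem_infinity).ne_zero
    (hM' _ X_notMem_infinity).exists_smul (hH' _ X_notMem_infinity).ne_zero
    (hH' _ X_notMem_infinity).exists_smul
  have hφ1 : φ ((1 : RatFunc K) ⊗ₜ[RatFunc K] (1 : RatFunc K)) = ε := by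
    have e : (RatFunc.X ^ n : RatFunc K) ⊗ₜ[RatFunc K] (RatFunc.X ^ n : RatFunc K) =
        (RatFunc.X ^ (2 * n) : RatFunc K) • ((1 : RatFunc K) ⊗ₜ[RatFunc K] (1 : RatFunc K)) := by
      rw [two_mul, pow_add, ← TensorProduct.smul_tmul_smul, smul_eq_mul, mul_one]
    refine (smul_right_injective _ (pow_ne_zero (2 * n) hX)) ?_
    exact ((map_smul φ _ _).symm.trans (congrArg φ e.symm)).trans hφ
  have key {P : Point K (RatFunc K)} {t : ((twist K n).tensor (twist K n)).gen}
      (ht : ((twist K n).tensor (twist K n)).IsLocalGenerator P t)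
      (ht' : ((CurveSheaf.tangent K (RatFunc K)).hom L).IsLocalGenerator P (φ t))
      (x : ((twist K n).tensor (twist K n)).gen) :
      φ x ∈ ((CurveSheaf.tangent K (RatFunc K)).hom L).stalk P ↔
        x ∈ ((twist K n).tensor (twist K n)).stalk P := by
    obtain ⟨a, rfl⟩ := ht.exists_smul x
    rw [map_smul, ht.smul_mem_iff, ht'.smul_mem_iff]
  refine ⟨⟨twist K n, twist_isLineBundle n, φ, fun P x => ?_⟩, (RatFunc.X ^ n : RatFunc K),
    (-(RatFunc.X : RatFunc K) ^ 2) • d, hd',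
    fun P hP => (twist_isLocalGenerator_of_notMem n hP).stalk_eq, ?_⟩
  · by_cases hP : RatFunc.X ∈ P.ring
    · exact key (hM P hP) (hφ1 ▸ hH P hP) x
    · exact key (hM' P hP) (hφ ▸ hH' P hP) x
  · refine Eq.trans ?_ hε'
    exact congrArg (fun f : (CurveSheaf.tangent K (RatFunc K)).gen →ₗ[RatFunc K] L.gen =>
      f ((-(RatFunc.X : RatFunc K) ^ 2) • d)) hφ

/-- The Nisnevich coordinate `1 / X` at infinity. -/
def NisnevichCoordinate.ofParam (hP : RatFunc.X ∉ P.ring) : NisnevichCoordinate P where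
  φ := P.param hP
  etale := (isLocalGenerator_cotangent_of_notMem hP).stalk_eq
  residue r := by
    obtain ⟨a, ha⟩ := P.exists_sub_algebraMap_mem_max hP r
    exact ⟨Polynomial.C a, by rwa [Polynomial.aeval_C]⟩

/-- The standard choice: coordinate `w = 1 / X` and `G = X ^ m`, which pulls back exactly to `w ^ m`
and so serves every `N`. Then `a` is the geometric sum and `η` the coefficient of the top power. -/
theorem nonempty_indexData {L : CurveSheaf K (RatFunc K)} {o : L.RelativeOrientation} {v : L.gen}
    (hP : RatFunc.X ∉ P.ring) {m : ℕ} (hm : 0 < m)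
    (hv : L.IsLocalGenerator P ((RatFunc.X ^ m : RatFunc K) • v))
    {s : o.M.gen} {d : (CurveSheaf.tangent K (RatFunc K)).gen}
    (hd : (show Ω[RatFunc K⁄K] →ₗ[RatFunc K] RatFunc K from d)
        (KaehlerDifferential.D K (RatFunc K) RatFunc.X⁻¹) = 1)
    (hs : o.M.stalk P = Submodule.span P.ring {s})
    (hcomp : (show (CurveSheaf.tangent K (RatFunc K)).gen →ₗ[RatFunc K] L.gen from
        o.iso (s ⊗ₜ[RatFunc K] s)) d = (RatFunc.X ^ m : RatFunc K) • v) (N : ℕ) :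
    Nonempty (IndexData o v P N) := by
  have hX : (RatFunc.X : RatFunc K) ≠ 0 := RatFunc.X_ne_zero
  let c := NisnevichCoordinate.ofParam hP
  have hpull : c.pull (c.X ^ m) = P.param hP ^ m := by
    rw [map_pow, c.pull_algebraMap, Polynomial.aeval_X]; rfl
  have hshift : c.shift 0 = c.X := by simp [NisnevichCoordinate.shift]
  have h0 : c.φ - algebraMap K P.ring 0 ∈ P.max := by
    rw [map_zero, sub_zero]
    exact P.param_mem_max hP
  have htr := c.isTruncatedBy hP h0 hm (G := c.X ^ m) (u := 1) (by simpa using hpull)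
  rw [hshift] at htr
  refine ⟨{
    coord := c
    d := d
    d_apply := hd
    e := (RatFunc.X ^ m : RatFunc K) • v
    stalk_eq := hv.stalk_eq
    s := s
    stalk_M_eq := hs
    compatible := hcomp
    f := P.param hP ^ m
    section_eq := ?_
    G := c.X ^ m
    approx := by rw [hpull, sub_self]; exact Ideal.zero_mem _
    a := ∑ i ∈ Finset.range m, (c.X ^ i) ⊗ₜ[K] (c.X ^ (m - 1 - i))
    a_eq := ?_
    η := htr.basis.coord ⟨m - 1, Nat.sub_lt htr.pos one_pos⟩
    η_eq := ?_ }⟩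
  · change v = ((RatFunc.X⁻¹ : RatFunc K) ^ m) • (RatFunc.X ^ m : RatFunc K) • v
    rw [smul_smul, inv_pow, inv_mul_cancel₀ (pow_ne_zero m hX), one_smul]
  · have h := geom_sum₂_mul (c.X ⊗ₜ[K] (1 : c.LocalRing)) ((1 : c.LocalRing) ⊗ₜ[K] c.X) m
    simp only [Algebra.TensorProduct.tmul_pow, one_pow, Algebra.TensorProduct.tmul_mul_tmul,
      mul_one, one_mul] at h
    exact h.symm
  · rw [map_sum]
    simp only [Algebra.TensorProduct.map_tmul, map_pow, Ideal.Quotient.mkₐ_eq_mk]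
    exact schejaStorch_geom_sum_coord htr

theorem hasLocalIndex_smul_hyp (h2 : (2 : K) ≠ 0) {L : CurveSheaf K (RatFunc K)}
    {o : L.RelativeOrientation} {v : L.gen} (hP : RatFunc.X ∉ P.ring) {m : ℕ} (hm : 0 < m)
    (hv : L.IsLocalGenerator P ((RatFunc.X ^ (2 * m) : RatFunc K) • v))
    {s : o.M.gen} {d : (CurveSheaf.tangent K (RatFunc K)).gen}
    (hd : (show Ω[RatFunc K⁄K] →ₗ[RatFunc K] RatFunc K from d)
        (KaehlerDifferential.D K (RatFunc K) RatFunc.X⁻¹) = 1)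
    (hs : o.M.stalk P = Submodule.span P.ring {s})
    (hcomp : (show (CurveSheaf.tangent K (RatFunc K)).gen →ₗ[RatFunc K] L.gen from
        o.iso (s ⊗ₜ[RatFunc K] s)) d = (RatFunc.X ^ (2 * m) : RatFunc K) • v) :
    HasLocalIndex o v P (m • GW.hyp K) := by
  have hX : (RatFunc.X : RatFunc K) ≠ 0 := RatFunc.X_ne_zero
  filter_upwards [Filter.eventually_gt_atTop (2 * m)] with N hN
  refine ⟨nonempty_indexData hP (by omega) hv hd hs hcomp N, fun D =>
    D.formClass_eq h2 hP hv hm ?_ hN⟩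
  change v = ((RatFunc.X⁻¹ : RatFunc K) ^ (2 * m)) • (RatFunc.X ^ (2 * m) : RatFunc K) • v
  rw [smul_smul, inv_pow, inv_mul_cancel₀ (pow_ne_zero _ hX), one_smul]

/-- Two candidate values are valid for a common large `N`, at which index data exist; both equal the
class of those data. -/
theorem HasLocalIndex.localIndex_eq {K F : Type u} [Field K] [Field F] [Algebra K F]
    {L : CurveSheaf K F} {o : L.RelativeOrientation} {σ : L.gen} {P : Point K F} {γ : GW K}
    (h : HasLocalIndex o σ P γ) : localIndex o σ P = γ := by
  have hex : ∃ γ, HasLocalIndex o σ P γ := ⟨γ, h⟩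
  rw [localIndex, dif_pos hex]
  obtain ⟨N, ⟨⟨D⟩, h₁⟩, h₂⟩ := (hex.choose_spec.and h).exists
  rw [← h₁ D, h₂.2 D]

end Orientation

/-! ### Pullback of line bundles and the degree of a map -/

section Pullback

variable {K FX FY : Type u} [Field K] [Field FX] [Field FY] [Algebra K FX] [Algebra K FY]

/-- The pullback of a rational section. -/
def CurveSheaf.pullbackSection (f : FX →ₐ[K] FY) (L : CurveSheaf K FX) (x : L.gen) :
    (L.pullback f).gen :=
  letI : Algebra FX FY := f.toRingHom.toAlgebra
  (1 : FY) ⊗ₜ[FX] x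

/-- The local ring at `P.map f` is the preimage of `P.ring`, so a regular coefficient `a` downstairs
becomes the regular coefficient `f a` upstairs. -/
theorem CurveSheaf.IsLocalGenerator.pullback {f : FX →ₐ[K] FY} {L : CurveSheaf K FX}
    {P : Point K FY} {e : L.gen} (h : L.IsLocalGenerator (P.map f) e) :
    (L.pullback f).IsLocalGenerator P (L.pullbackSection f e) := by
  let : Algebra FX FY := f.toRingHom.toAlgebra
  have hsmul (a : FX) : (1 : FY) ⊗ₜ[FX] (a • e) = f a • ((1 : FY) ⊗ₜ[FX] e) := by
    rw [TensorProduct.tmul_smul]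
    exact (algebraMap_smul FY a _).symm
  refine of_span rfl ?_ ?_ ⟨e, h.self_mem, rfl⟩ ?_
  · obtain ⟨g, hg⟩ := exists_linearMap_apply_eq (F := FX) h.ne_zero (1 : FX)
    intro h0
    have h1 := congrArg (TensorProduct.rid FX FY ∘ LinearMap.lTensor FY g) h0
    change TensorProduct.rid FX FY (LinearMap.lTensor FY g ((1 : FY) ⊗ₜ[FX] e)) =
      TensorProduct.rid FX FY (LinearMap.lTensor FY g (0 : FY ⊗[FX] L.gen)) at h1
    simp [hg] at h1
  · intro x
    change FY ⊗[FX] L.gen at x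
    change ∃ a : FY, x = a • ((1 : FY) ⊗ₜ[FX] e)
    induction x with
    | zero => exact ⟨0, (zero_smul FY _).symm⟩
    | tmul y z =>
      obtain ⟨a, rfl⟩ := h.exists_smul z
      refine ⟨y * f a, ?_⟩
      rw [mul_smul, ← hsmul, TensorProduct.smul_tmul', smul_eq_mul, mul_one]
    | add x y hx hy =>
      obtain ⟨a, rfl⟩ := hx
      obtain ⟨b, rfl⟩ := hy
      exact ⟨a + b, (add_smul _ _ _).symm⟩
  · rintro _ ⟨x, hx, rfl⟩
    obtain ⟨a, rfl⟩ := h.exists_smul x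
    exact ⟨f a, (h.smul_mem_iff a).1 hx, hsmul a⟩

theorem differential_pullbackSection (f : FX →ₐ[K] FY) (x : FX) :
    (show ((CurveSheaf.cotangent K FX).pullback f).gen →ₗ[FY] (CurveSheaf.cotangent K FY).gen from
      differential f) ((CurveSheaf.cotangent K FX).pullbackSection f
        (KaehlerDifferential.D K FX x)) = KaehlerDifferential.D K FY (f x) := by
  let : Algebra FX FY := f.toRingHom.toAlgebra
  have : IsScalarTower K FX FY := .of_algebraMap_eq fun c => (f.commutes c).symm
  refine (KaehlerDifferential.mapBaseChange_tmul K FX FY (1 : FY) _).trans ?_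
  rw [one_smul]
  exact KaehlerDifferential.map_D K K FX FY x

theorem mapDegree_eq (f : FX →ₐ[K] FY) : mapDegree f = Module.finrank f.fieldRange FY := by
  let : Algebra FX FY := f.toRingHom.toAlgebra
  exact Algebra.finrank_eq_of_equiv_equiv (AlgEquiv.ofInjectiveField f).toRingEquiv
    (RingEquiv.refl FY) (RingHom.ext fun _ => rfl)

end Pullback

/-! ### The Artin–Schreier map: fibre over infinity, degree and zeros of `df` -/

theorem D_X_pow_sub_X {K : Type u} [Field K] (p : ℕ) [CharP K p] :
    KaehlerDifferential.D K (RatFunc K) (RatFunc.X ^ p - RatFunc.X) =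
    (-1 : RatFunc K) • KaehlerDifferential.D K (RatFunc K) RatFunc.X := by
  have : CharP (RatFunc K) p := charP_of_injective_algebraMap (algebraMap K (RatFunc K)).injective p
  rw [map_sub, Derivation.leibniz_pow, ← Nat.cast_smul_eq_nsmul (RatFunc K), CharP.cast_eq_zero,
    zero_smul, zero_sub, neg_smul, one_smul]

section ArtinSchreier

variable {K : Type u} [Field K] (p : ℕ) [hp : Fact p.Prime] {P : Point K (RatFunc K)}

theorem X_pow_sub_X_eq : (RatFunc.X ^ p - RatFunc.X : RatFunc K) =
    RatFunc.X ^ p * (1 - RatFunc.X⁻¹ ^ (p - 1)) := by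
  have hX : (RatFunc.X : RatFunc K) ≠ 0 := RatFunc.X_ne_zero
  obtain ⟨q, rfl⟩ : ∃ q, p = q + 1 := ⟨p - 1, (Nat.sub_add_cancel hp.out.one_le).symm⟩
  rw [Nat.add_sub_cancel, inv_pow, mul_sub, mul_one, pow_succ', mul_inv_cancel_right₀
    (pow_ne_zero q hX)]

theorem exists_unit_eq (hP : RatFunc.X ∉ P.ring) :
    ∃ u : P.ringˣ, ((u : P.ring) : RatFunc K) = 1 - (RatFunc.X : RatFunc K)⁻¹ ^ (p - 1) := by
  have h1 : p - 1 ≠ 0 := Nat.sub_ne_zero_of_lt hp.out.one_lt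
  obtain ⟨u, hu⟩ := P.isUnit_aeval_param hP (q := 1 - Polynomial.X ^ (p - 1))
    (by simp [Polynomial.coeff_X_pow, h1.symm])
  refine ⟨u, ?_⟩
  rw [hu, P.coe_aeval]
  simp only [map_sub, map_one, map_pow, Polynomial.aeval_X]
  rfl

/-- Infinity is the only point over infinity: there `X ^ p - X` is `X ^ p` times a unit, so it is
regular only if `X ^ p` is, against the degree criterion. -/
theorem X_mem_map_artinSchreier_iff :
    RatFunc.X ∈ (P.map (artinSchreier K p)).ring ↔ RatFunc.X ∈ P.ring := by
  change artinSchreier K p RatFunc.X ∈ P.ring ↔ _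
  rw [artinSchreier_X]
  refine ⟨fun h => ?_, fun h => sub_mem (pow_mem h p) h⟩
  by_contra hP
  obtain ⟨u, hu⟩ := exists_unit_eq p hP
  have hu0 : (1 - (RatFunc.X : RatFunc K)⁻¹ ^ (p - 1)) ≠ 0 := hu ▸ Point.coe_unit_ne_zero u
  have huu : ((u : P.ring) : RatFunc K) * ((u⁻¹ : P.ringˣ) : P.ring) = 1 :=
    congrArg Subtype.val u.mul_inv
  have h1 : (RatFunc.X : RatFunc K) ^ p ∈ P.ring := by
    have := mul_mem h ((u⁻¹ : P.ringˣ) : P.ring).2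
    rwa [X_pow_sub_X_eq, ← hu, mul_assoc, huu, mul_one] at this
  rw [P.mem_ring_iff_intDegree hP (pow_ne_zero p RatFunc.X_ne_zero), ← RatFunc.algebraMap_X,
    ← map_pow, RatFunc.intDegree_polynomial, Polynomial.natDegree_X_pow] at h1
  have := hp.out.pos
  omega

/-- The image of the function field is `K(X ^ p - X)`, and the degree of `K(X)` over `K(g)` is the
larger of the degrees of numerator and denominator of `g`. -/
theorem mapDegree_artinSchreier : mapDegree (artinSchreier K p) = p := by
  have hr : (artinSchreier K p).fieldRange =
      IntermediateField.adjoin K {(RatFunc.X ^ p - RatFunc.X : RatFunc K)} := by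
    rw [AlgHom.fieldRange_eq_map, ← RatFunc.adjoin_X,
      IntermediateField.adjoin_map, Set.image_singleton, artinSchreier_X]
  have hg : (RatFunc.X ^ p - RatFunc.X : RatFunc K) =
      algebraMap K[X] (RatFunc K) (Polynomial.X ^ p - Polynomial.X) := by simp
  rw [mapDegree_eq, hr, RatFunc.finrank_eq_max_natDegree, hg, RatFunc.num_algebraMap,
    RatFunc.denom_algebraMap, Polynomial.natDegree_one, Nat.max_zero]
  exact FiniteField.X_pow_card_sub_X_natDegree_eq K hp.out.one_lt

variable [CharP K p]

theorem isLocalGenerator_differential_of_mem (hP : RatFunc.X ∈ P.ring) :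
    (differentialSheaf (artinSchreier K p)).IsLocalGenerator P
      (differential (artinSchreier K p)) := by
  have h1 := (isLocalGenerator_cotangent_of_mem
    ((X_mem_map_artinSchreier_iff p).2 hP)).pullback (f := artinSchreier K p)
  have h2 := (isLocalGenerator_cotangent_of_mem hP).unit_smul (c := -1) (neg_mem (one_mem _))
      (by rw [inv_neg, inv_one]; exact neg_mem (one_mem _)) (by simp)
  refine h1.hom h2 ((differential_pullbackSection _ _).trans ?_)
  rw [artinSchreier_X]
  exact D_X_pow_sub_X p

/-- With `w = 1 / X` and `u = 1 - w ^ (p - 1)`, the generator `d(1 / x)` pulls back to `d(w ^ p *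
u⁻¹) = -w ^ (2 * (p - 1)) * u⁻² dw`. The power of `X` clears the zero and leaves the unit `-u⁻²`. -/
theorem isLocalGenerator_differential_of_notMem (hP : RatFunc.X ∉ P.ring) :
    (differentialSheaf (artinSchreier K p)).IsLocalGenerator P
      ((RatFunc.X ^ (2 * (p - 1)) : RatFunc K) • differential (artinSchreier K p)) := by
  have hX : (RatFunc.X : RatFunc K) ≠ 0 := RatFunc.X_ne_zero
  have h1 := (isLocalGenerator_cotangent_of_notMem
    (mt (X_mem_map_artinSchreier_iff p).1 hP)).pullback (f := artinSchreier K p)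
  obtain ⟨u, hu⟩ := exists_unit_eq p hP
  have hu0 : ((u : P.ring) : RatFunc K) ≠ 0 := Point.coe_unit_ne_zero u
  have huu : ((u : P.ring) : RatFunc K)⁻¹ = ((u⁻¹ : P.ringˣ) : P.ring) :=
    (eq_inv_of_mul_eq_one_right (congrArg Subtype.val u.mul_inv)).symm
  have h2 := (isLocalGenerator_cotangent_of_notMem hP).unit_smul
    (c := -((u : P.ring) : RatFunc K)⁻¹ ^ 2)
    (by rw [huu]; exact neg_mem (pow_mem (Subtype.property _) 2))
    (by rw [inv_neg, inv_pow, inv_inv]; exact neg_mem (pow_mem (Subtype.property _) 2))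
    (neg_ne_zero.2 (pow_ne_zero 2 (inv_ne_zero hu0)))
  refine h1.hom h2 ((congrArg
    (fun ω : Ω[RatFunc K⁄K] => (RatFunc.X ^ (2 * (p - 1)) : RatFunc K) • ω)
    (differential_pullbackSection (artinSchreier K p) RatFunc.X⁻¹)).trans ?_)
  change (RatFunc.X ^ (2 * (p - 1)) : RatFunc K) • KaehlerDifferential.D K (RatFunc K) _ =
    (_ : RatFunc K) • KaehlerDifferential.D K (RatFunc K) RatFunc.X⁻¹
  rw [map_inv₀, artinSchreier_X, Derivation.leibniz_inv, D_X_pow_sub_X, D_X_inv, X_pow_sub_X_eq,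
    ← hu, smul_smul, smul_smul, smul_smul]
  congr 1
  obtain ⟨q, hq⟩ : ∃ q, p = q + 1 := ⟨p - 1, (Nat.sub_add_cancel hp.out.one_le).symm⟩
  rw [show p - 1 = q by omega, hq]
  field_simp
  ring

theorem ramificationPoints_artinSchreier :
    ramificationPoints (artinSchreier K p) = {infinity K} := by
  have h1 : p - 1 ≠ 0 := Nat.sub_ne_zero_of_lt hp.out.one_lt
  ext P
  rw [Set.mem_singleton_iff, Point.eq_infinity_iff]
  change (differentialSheaf (artinSchreier K p)).Vanishes (differential (artinSchreier K p)) P ↔ _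
  constructor
  · intro h hP
    have h' := (isLocalGenerator_differential_of_mem p hP).vanishes_iff 1
    rw [OneMemClass.coe_one, one_smul] at h'
    exact h'.1 h isUnit_one
  · intro hP
    have h' := (isLocalGenerator_differential_of_notMem p hP).vanishes_iff
      (P.param hP ^ (2 * (p - 1)))
    have e : ((P.param hP ^ (2 * (p - 1)) : P.ring) : RatFunc K) •
        (RatFunc.X ^ (2 * (p - 1)) : RatFunc K) • differential (artinSchreier K p) =
          differential (artinSchreier K p) := by
      change ((RatFunc.X⁻¹ : RatFunc K) ^ (2 * (p - 1))) • _ = _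
      rw [smul_smul, inv_pow, inv_mul_cancel₀ (pow_ne_zero _ RatFunc.X_ne_zero), one_smul]
    rw [e] at h'
    exact h'.2 (Ideal.pow_mem_of_mem _ (P.param_mem_max hP) _ (by omega))

end ArtinSchreier

end EnrichedRH

end

theorem proposition3p2 {k : Type*} [Field k] (p : ℕ) [Fact p.Prime] [CharP k p] (hp : p ≠ 2) :
    ∃ o : (EnrichedRH.differentialSheaf
        (EnrichedRH.artinSchreier (RatFunc k) p)).RelativeOrientation,
      EnrichedRH.ramificationPoints (EnrichedRH.artinSchreier (RatFunc k) p) =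
          {EnrichedRH.infinity (RatFunc k)} ∧
        EnrichedRH.HasLocalIndex o
          (EnrichedRH.differential (EnrichedRH.artinSchreier (RatFunc k) p))
          (EnrichedRH.infinity (RatFunc k)) ((p - 1) • EnrichedRH.GW.hyp (RatFunc k)) ∧
        EnrichedRH.EnrichedRiemannHurwitz (EnrichedRH.artinSchreier (RatFunc k) p) o := by
  have hprime : p.Prime := Fact.out
  have hchar : CharP (RatFunc k) p :=
    charP_of_injective_algebraMap (algebraMap k (RatFunc k)).injective p
  -- Oddness of `p` is needed for halving when the hyperbolic planes are split off.
  have h2 : (2 : RatFunc k) ≠ 0 := by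
    intro h
    have h' : ((2 : ℕ) : RatFunc k) = 0 := by exact_mod_cast h
    exact hp ((Nat.prime_dvd_prime_iff_eq hprime Nat.prime_two).1
      ((CharP.cast_eq_zero_iff (RatFunc k) p 2).1 h'))
  have h1 : p - 1 = p - 2 + 1 := by
    have := hprime.two_le
    omega
  obtain ⟨o, s, d, hd, hs, hcomp⟩ := EnrichedRH.exists_relativeOrientation (n := p - 2)
    (v := EnrichedRH.differential (EnrichedRH.artinSchreier (RatFunc k) p))
    (fun P hP => EnrichedRH.isLocalGenerator_differential_of_mem p hP)
    (fun P hP => h1 ▸ EnrichedRH.isLocalGenerator_differential_of_notMem p hP)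
  rw [← h1] at hcomp
  have hind := EnrichedRH.hasLocalIndex_smul_hyp h2 EnrichedRH.X_notMem_infinity
    (show 0 < p - 1 by omega)
    (EnrichedRH.isLocalGenerator_differential_of_notMem p EnrichedRH.X_notMem_infinity) hd
    (hs _ EnrichedRH.X_notMem_infinity) hcomp
  refine ⟨o, EnrichedRH.ramificationPoints_artinSchreier p, hind, ?_⟩
  rw [EnrichedRH.EnrichedRiemannHurwitz, EnrichedRH.ramificationPoints_artinSchreier,
    finsum_mem_singleton, hind.localIndex_eq, EnrichedRH.mapDegree_artinSchreier,
    EnrichedRH.eulerChar_ratFunc]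
  -- What remains is `h = p • h - (p - 1) • h`.
  conv_rhs => rw [show p = (p - 1) + 1 by omega, succ_nsmul]
  rw [Nat.add_sub_cancel, add_sub_cancel_left]
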